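/- Let $1\le \ell\le n-1$ and let $\Omega\subset\mathbb R^n$ be a bounded domain (a nonempty, connected, bounded open set) with $\rho_\Omega(x)=\mathrm{dist}(x,\partial\Omega)$. Let $\Lambda^k$ be the space of $k$-forms on $\mathbb R^n$ with the Euclidean norm for which the $dx_{i_1}\wedge\dots\wedge dx_{i_k}$, $i_1<\dots<i_k$, are orthonormal, let $\|\cdot\|$ and $\langle\cdot,\cdot\rangle$ be the norm and inner product of $L_2(\Omega,\Lambda^k)$, let $d$ be the exterior derivative and $d^*$ its formal $L_2$-adjoint, and let $H_0^1(\Omega,\Lambda^\ell)$ be the completion of $C_0^\infty(\Omega,\Lambda^\ell)$ under $|w|_1=\langle (d^*d+dd^*)w,w\rangle^{1/2}=(\|dw\|^2+\|d^*w\|^2)^{1/2}$. On $L_2$-forms, $d$ and $d^*$ are taken in the sense of distributions. Let $$M=\{u\in L_2(\Omega,\Lambda^{\ell-1}) : \langle u,v\rangle=0 \text{ for all } v\in L_2(\Omega,\Lambda^{\ell-1}) \text{ with } dv=0\}.$$ Say that $\Omega$ supports - the Hardy inequality if for some finite constant $H>0$: $\int_\Omega \rho_\Omega^{-2}|v|^2\le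 H\int_\Omega|\nabla v|^2$ for all scalar $v\in H_0^1(\Omega)$; - the Babuška–Aziz inequality of order $\ell$ if for some finite constant $C>0$: for every $u\in M$ there is $w\in H_0^1(\Omega,\Lambda^\ell)$ with $d^*w=u$ and $|w|_1^2\le C\|u\|^2$; - the Friedrichs–Velte inequality of order $\ell$ if for some finite constant $\Gamma>0$: $\|u\|^2\le\Gamma\|v\|^2$ for all $u\in M$ and $v\in L_2(\Omega,\Lambda^{\ell+1})$ with $du=d^*v$; - the improved Poincaré inequality of order $\ell$ if for some finite constant $P>0$: $\|u\|^2\le P\,\|\rho_\Omega\,du\|^2$ for all $u\in M$, where $\|\rho_\Omega\,du\|=\infty$ unless the distribution $du$ is a function with $\rho_\Omega\,du\in L_2(\Omega,\Lambda^\ell)$. The optimal constants $H_\Omega$, $C_{\Omega,\ell}$, $\Gamma_{\Omega,\ell}$, $P_{\Omega,\ell}$ are the infima of the admissible constants in the respective inequalities. Suppose that $\Omega$ supports the Hardy inequality. Then $\Omega$ supports the Friedrichs–Velte inequality of order $\ell$ if and only if it supports the improved Poincaré inequality of order $\ell$, and $\Omega$ supports the Babuška–Aziz inequality of order $\ell$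 if and only if it supports the improved Poincaré inequality of order $\ell$. Moreover, when these inequalities are supported, $$\tfrac14\left(C_{\Omega,\ell}-1\right)=\tfrac14\,\Gamma_{\Omega,\ell}\le P_{\Omega,\ell}\le H_\Omega\, C_{\Omega,\ell}=H_\Omega\left(1+\Gamma_{\Omega,\ell}\right).$$ -/

import Mathlib

open MeasureTheory Set
open scoped ContDiff

noncomputable section

namespace FormIneq

/-- The space `ℝⁿ` with its Euclidean structure. -/
abbrev E (n : ℕ) : Type := EuclideanSpace ℝ (Fin n)

/-- Increasing multi-indices `i₁ < ⋯ < i_ℓ` in `{1, …, n}`, as `ℓ`-element sets. -/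
abbrev MIdx (n ℓ : ℕ) : Type := {I : Finset (Fin n) // I.card = ℓ}

/-- `Λ^ℓ`: a form `∑_I a_I dx_I` is given by its coefficients; the `dx_I` are orthonormal, so that
the norm is the Euclidean norm `|·|` on `Λ^ℓ`. -/
abbrev Form (n ℓ : ℕ) : Type := EuclideanSpace ℝ (MIdx n ℓ)

/-- The sign `ε` with `dx_i ∧ dx_J = ∑_I ε i J I dx_I`. It vanishes unless `i ∉ J` and
`I = J ∪ {i}`, and is then `(-1)` to the number of elements of `J` below `i`. -/
def wedgeSign {n : ℕ} (i : Fin n) (J I : Finset (Fin n)) : ℝ :=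
  if i ∉ J ∧ I = insert i J then (-1) ^ (J.filter (· < i)).card else 0

/-- `∂_i φ_J (x)`. -/
def partialCoeff {n ℓ : ℕ} (φ : E n → Form n ℓ) (x : E n) (i : Fin n) (J : MIdx n ℓ) : ℝ :=
  (fderiv ℝ φ x (EuclideanSpace.single i (1 : ℝ))) J

/-- The exterior derivative `dφ = ∑_{i,J} ∂_i φ_J dx_i ∧ dx_J`; it is `0` for `ℓ = n`. -/
def extD {n ℓ : ℕ} (φ : E n → Form n ℓ) (x : E n) : Form n (ℓ + 1) :=
  WithLp.toLp 2 fun I => ∑ i : Fin n, ∑ J : MIdx n ℓ, wedgeSign i J.1 I.1 * partialCoeff φ x i J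

/-- The coderivative `d*`, the formal `L₂`-adjoint of the exterior derivative
`Λ^(ℓ-1) → Λ^ℓ`; it is `0` for `ℓ = 0`. -/
def codiff {n ℓ : ℕ} (φ : E n → Form n ℓ) (x : E n) : Form n (ℓ - 1) :=
  WithLp.toLp 2 fun J => -∑ i : Fin n, ∑ I : MIdx n ℓ, wedgeSign i J.1 I.1 * partialCoeff φ x i I

/-- The coefficients `α(e_{i₁}, …, e_{i_ℓ})`, `i₁ < ⋯ < i_ℓ`, of an alternating form. -/
def coeffs {n : ℕ} (ℓ : ℕ) (α : E n [⋀^Fin ℓ]→L[ℝ] ℝ) : Form n ℓ :=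
  WithLp.toLp 2 fun I => α fun j => EuclideanSpace.single (I.1.orderEmbOfFin I.2 j) (1 : ℝ)

theorem filter_erase_card {n ℓ : ℕ} (I : Finset (Fin n)) (hI : I.card = ℓ + 1) (j : Fin (ℓ + 1)) :
    ((I.erase (I.orderEmbOfFin hI j)).filter (· < I.orderEmbOfFin hI j)).card = j := by
  have h : (I.erase (I.orderEmbOfFin hI j)).filter (· < I.orderEmbOfFin hI j)
      = (Finset.Iio j).map (I.orderEmbOfFin hI).toEmbedding := by
    ext a
    simp only [Finset.mem_filter, Finset.mem_erase, Finset.mem_map, Finset.mem_Iio]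
    constructor
    · rintro ⟨⟨_, ha⟩, hlt⟩
      have : a ∈ Set.range (I.orderEmbOfFin hI) := by
        rw [Finset.range_orderEmbOfFin]; exact ha
      obtain ⟨k, rfl⟩ := this
      exact ⟨k, (I.orderEmbOfFin hI).lt_iff_lt.1 hlt, rfl⟩
    · rintro ⟨k, hk, rfl⟩
      have := (I.orderEmbOfFin hI).lt_iff_lt.2 hk
      exact ⟨⟨this.ne, Finset.orderEmbOfFin_mem _ _ _⟩, this⟩
  rw [h, Finset.card_map, Fin.card_Iio]

theorem orderEmbOfFin_erase {n ℓ : ℕ} (I : Finset (Fin n)) (hI : I.card = ℓ + 1)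
    (j : Fin (ℓ + 1)) (h : (I.erase (I.orderEmbOfFin hI j)).card = ℓ) (k : Fin ℓ) :
    (I.erase (I.orderEmbOfFin hI j)).orderEmbOfFin h k = I.orderEmbOfFin hI (j.succAbove k) := by
  have := Finset.orderEmbOfFin_unique h (f := fun k => I.orderEmbOfFin hI (j.succAbove k))
    (fun k => by
      simp only [Finset.mem_erase, Finset.orderEmbOfFin_mem, and_true]
      exact fun hh => Fin.succAbove_ne j k ((I.orderEmbOfFin hI).injective hh))
    ((I.orderEmbOfFin hI).strictMono.comp (Fin.strictMono_succAbove j))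
  exact (congrFun this k).symm

theorem partialCoeff_coeffs {n ℓ : ℕ} (η : E n → E n [⋀^Fin ℓ]→L[ℝ] ℝ) (x : E n)
    (h : DifferentiableAt ℝ η x) (i : Fin n) (J : MIdx n ℓ) :
    partialCoeff (fun y => coeffs ℓ (η y)) x i J =
      (coeffs ℓ (fderiv ℝ η x (EuclideanSpace.single i 1))) J := by
  let L : (E n [⋀^Fin ℓ]→L[ℝ] ℝ) →L[ℝ] Form n ℓ :=
    (PiLp.continuousLinearEquiv 2 ℝ fun _ : MIdx n ℓ => ℝ).symm.toContinuousLinearMap.comp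
      (ContinuousLinearMap.pi fun I => ContinuousAlternatingMap.apply ℝ (E n) ℝ
        fun j => EuclideanSpace.single (I.1.orderEmbOfFin I.2 j) (1 : ℝ))
  have h2 : HasFDerivAt (fun y => coeffs ℓ (η y)) (L.comp (fderiv ℝ η x)) x :=
    L.hasFDerivAt.comp x h.hasFDerivAt
  rw [partialCoeff, h2.fderiv]
  rfl

/-- In coefficients, Mathlib's exterior derivative is `extD`. -/
theorem coeffs_extDeriv {n ℓ : ℕ} (η : E n → E n [⋀^Fin ℓ]→L[ℝ] ℝ) (x : E n)
    (h : DifferentiableAt ℝ η x) :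
    coeffs (ℓ + 1) (extDeriv η x) = extD (fun y => coeffs ℓ (η y)) x := by
  ext I
  obtain ⟨I, hI⟩ := I
  have key : ∀ j : Fin (ℓ + 1), ∀ g : MIdx n ℓ → ℝ,
      ∑ J : MIdx n ℓ, wedgeSign (I.orderEmbOfFin hI j) J.1 I * g J =
      (-1) ^ (j : ℕ) * g ⟨I.erase (I.orderEmbOfFin hI j), by
        rw [Finset.card_erase_of_mem (Finset.orderEmbOfFin_mem _ _ _), hI]; rfl⟩ := by
    intro j g
    rw [Finset.sum_eq_single ⟨I.erase (I.orderEmbOfFin hI j), by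
        rw [Finset.card_erase_of_mem (Finset.orderEmbOfFin_mem _ _ _), hI]; rfl⟩]
    · rw [wedgeSign, if_pos, filter_erase_card]
      exact ⟨Finset.notMem_erase _ _,
        (Finset.insert_erase (Finset.orderEmbOfFin_mem _ _ _)).symm⟩
    · rintro ⟨J, hJ⟩ - hne
      rw [wedgeSign, if_neg, zero_mul]
      rintro ⟨h1, h2⟩
      apply hne
      ext1
      change J = I.erase (I.orderEmbOfFin hI j)
      exact (Finset.erase_insert h1).symm.trans (congrArg (Finset.erase · _) h2.symm)
    · simp
  have lhs : coeffs (ℓ + 1) (extDeriv η x) ⟨I, hI⟩ = ∑ j : Fin (ℓ + 1), (-1) ^ (j : ℕ) *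
      (coeffs ℓ (fderiv ℝ η x (EuclideanSpace.single (I.orderEmbOfFin hI j) 1)))
      ⟨I.erase (I.orderEmbOfFin hI j), by
        rw [Finset.card_erase_of_mem (Finset.orderEmbOfFin_mem _ _ _), hI]; rfl⟩ := by
    simp only [coeffs, extDeriv, ContinuousAlternatingMap.alternatizeUncurryFin_apply]
    refine Finset.sum_congr rfl fun j _ => ?_
    simp only [orderEmbOfFin_erase, zsmul_eq_mul, Int.cast_pow, Int.cast_neg, Int.cast_one]
    rfl
  rw [lhs]
  simp only [extD, partialCoeff_coeffs η x h]
  have z : ∀ i ∉ Set.range (I.orderEmbOfFin hI), ∑ J : MIdx n ℓ, wedgeSign i J.1 I *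
      (coeffs ℓ (fderiv ℝ η x (EuclideanSpace.single i 1))) J = 0 := by
    intro i hi
    refine Finset.sum_eq_zero fun J _ => ?_
    rw [wedgeSign, if_neg, zero_mul]
    rintro ⟨-, h2⟩
    rw [Finset.range_orderEmbOfFin] at hi
    exact hi (by rw [h2]; simp)
  exact Fintype.sum_of_injective _ (I.orderEmbOfFin hI).injective _ _ z (fun j => (key j _).symm)

/-- Smooth `ℓ`-forms with compact support in `Ω`. -/
def IsTestForm {n : ℕ} (Ω : Set (E n)) {ℓ : ℕ} (φ : E n → Form n ℓ) : Prop :=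
  ContDiff ℝ ∞ φ ∧ HasCompactSupport φ ∧ tsupport φ ⊆ Ω

/-- `L₂(Ω, Λ^ℓ)`. -/
abbrev L2Form {n : ℕ} (Ω : Set (E n)) (ℓ : ℕ) : Type :=
  Lp (Form n ℓ) 2 (volume.restrict Ω)

/-- `H₀¹(Ω, Λ^ℓ)`, the completion of the test forms for `|φ|₁² = ⟨Δφ, φ⟩ = ‖dφ‖² + ‖d*φ‖²`.
As `Ω` is bounded, the Poincaré inequality makes it a subspace of `L₂(Ω, Λ^ℓ)`; an element `w`
is recorded as the triple `(w, dw, d*w)`, a limit in `L₂` of triples `(φ, dφ, d*φ)`. -/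
def H01Form {n : ℕ} (Ω : Set (E n)) (ℓ : ℕ) :
    Set (L2Form Ω ℓ × L2Form Ω (ℓ + 1) × L2Form Ω (ℓ - 1)) :=
  closure {t | ∃ φ : E n → Form n ℓ, IsTestForm Ω φ ∧
    t.1 =ᵐ[volume.restrict Ω] φ ∧
    t.2.1 =ᵐ[volume.restrict Ω] extD φ ∧
    t.2.2 =ᵐ[volume.restrict Ω] codiff φ}

/-- `du = 0` in the sense of distributions, for `u ∈ L₂(Ω, Λ^(ℓ-1))`. -/
def InKerD {n : ℕ} (Ω : Set (E n)) (ℓ : ℕ) (u : L2Form Ω (ℓ - 1)) : Prop :=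
  ∀ φ : E n → Form n ℓ, IsTestForm Ω φ → ∫ x in Ω, inner ℝ (u x) (codiff φ x) = 0

/-- `M`, the orthogonal complement in `L₂(Ω, Λ^(ℓ-1))` of the kernel of `d`. -/
def spaceM {n : ℕ} (Ω : Set (E n)) (ℓ : ℕ) : Set (L2Form Ω (ℓ - 1)) :=
  {u | ∀ v : L2Form Ω (ℓ - 1), InKerD Ω ℓ v → inner ℝ u v = 0}

/-- `u ∈ L₂(Ω, Λ^(ℓ-1))` and `v ∈ L₂(Ω, Λ^(ℓ+1))` are conjugate: `du = d*v` as distributions. -/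
def Conjugate {n : ℕ} (Ω : Set (E n)) (ℓ : ℕ) (u : L2Form Ω (ℓ - 1)) (v : L2Form Ω (ℓ + 1)) :
    Prop :=
  ∀ φ : E n → Form n ℓ, IsTestForm Ω φ →
    ∫ x in Ω, inner ℝ (u x) (codiff φ x) = ∫ x in Ω, inner ℝ (v x) (extD φ x)

/-- The distance to the boundary. -/
def bdryDist {n : ℕ} (Ω : Set (E n)) (x : E n) : ℝ := Metric.infDist x (frontier Ω)

/-- The distribution `du` is the function `f` on `Ω`, for `u ∈ L₂(Ω, Λ^(ℓ-1))`. -/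
def HasWeakD {n : ℕ} (Ω : Set (E n)) (ℓ : ℕ) (u : L2Form Ω (ℓ - 1)) (f : E n → Form n ℓ) : Prop :=
  ∀ φ : E n → Form n ℓ, IsTestForm Ω φ →
    ∫ x in Ω, inner ℝ (u x) (codiff φ x) = ∫ x in Ω, inner ℝ (f x) (φ x)

/-- The Babuška–Aziz inequality of order `ℓ` with constant `c`. -/
def BAWith {n : ℕ} (Ω : Set (E n)) (ℓ : ℕ) (c : ℝ) : Prop :=
  ∀ u ∈ spaceM Ω ℓ, ∃ w ∈ H01Form Ω ℓ,
    w.2.2 = u ∧ ‖w.2.1‖ ^ 2 + ‖w.2.2‖ ^ 2 ≤ c * ‖u‖ ^ 2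

/-- The Friedrichs–Velte inequality of order `ℓ` with constant `c`. -/
def FVWith {n : ℕ} (Ω : Set (E n)) (ℓ : ℕ) (c : ℝ) : Prop :=
  ∀ u ∈ spaceM Ω ℓ, ∀ v : L2Form Ω (ℓ + 1), Conjugate Ω ℓ u v → ‖u‖ ^ 2 ≤ c * ‖v‖ ^ 2

/-- The improved Poincaré inequality `‖u‖² ≤ c ‖ρ du‖²` of order `ℓ` with constant `c`, for all
`u ∈ M`. The right-hand side is `+∞`, and there is nothing to show, unless the distribution `du` is
a function `f` on `Ω` with `ρ f` square integrable. -/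
def IPWith {n : ℕ} (Ω : Set (E n)) (ℓ : ℕ) (c : ℝ) : Prop :=
  ∀ u ∈ spaceM Ω ℓ, ∀ f : E n → Form n ℓ,
    MemLp (fun x => bdryDist Ω x • f x) 2 (volume.restrict Ω) → HasWeakD Ω ℓ u f →
    ‖u‖ ^ 2 ≤ c * ∫ x in Ω, ‖bdryDist Ω x • f x‖ ^ 2

/-- `H₀¹(Ω)` for scalar functions: pairs `(v, ∇v)`, the `L₂`-limits of pairs `(φ, ∇φ)` with
`φ ∈ C₀^∞(Ω)`. -/
def H01 {n : ℕ} (Ω : Set (E n)) :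
    Set (Lp ℝ 2 (volume.restrict Ω) × Lp (E n) 2 (volume.restrict Ω)) :=
  closure {t | ∃ φ : E n → ℝ, (ContDiff ℝ ∞ φ ∧ HasCompactSupport φ ∧ tsupport φ ⊆ Ω) ∧
    t.1 =ᵐ[volume.restrict Ω] φ ∧ t.2 =ᵐ[volume.restrict Ω] gradient φ}

/-- The Hardy inequality `∫ |v|² / ρ² ≤ c ∫ |∇v|²`, `v ∈ H₀¹(Ω)`, with constant `c`. -/
def HardyWith {n : ℕ} (Ω : Set (E n)) (c : ℝ) : Prop :=
  ∀ v ∈ H01 Ω,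
    ∫⁻ x in Ω, ENNReal.ofReal ((v.1 x) ^ 2 / (bdryDist Ω x) ^ 2) ≤ ENNReal.ofReal (c * ‖v.2‖ ^ 2)

/-- `Ω` supports the inequality if it holds with some finite positive constant. -/
def SupportsHardy {n : ℕ} (Ω : Set (E n)) : Prop := ∃ c : ℝ, 0 < c ∧ HardyWith Ω c
def SupportsBA {n : ℕ} (Ω : Set (E n)) (ℓ : ℕ) : Prop := ∃ c : ℝ, 0 < c ∧ BAWith Ω ℓ c
def SupportsFV {n : ℕ} (Ω : Set (E n)) (ℓ : ℕ) : Prop := ∃ c : ℝ, 0 < c ∧ FVWith Ω ℓ c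
def SupportsIP {n : ℕ} (Ω : Set (E n)) (ℓ : ℕ) : Prop := ∃ c : ℝ, 0 < c ∧ IPWith Ω ℓ c

/-- The optimal constants `H_Ω`, `C_{Ω,ℓ}`, `Γ_{Ω,ℓ}`, `P_{Ω,ℓ}`; meaningful when the respective
inequality is supported. -/
def hardyConst {n : ℕ} (Ω : Set (E n)) : ℝ := sInf {c : ℝ | 0 < c ∧ HardyWith Ω c}
def baConst {n : ℕ} (Ω : Set (E n)) (ℓ : ℕ) : ℝ := sInf {c : ℝ | 0 < c ∧ BAWith Ω ℓ c}
def fvConst {n : ℕ} (Ω : Set (E n)) (ℓ : ℕ) : ℝ := sInf {c : ℝ | 0 < c ∧ FVWith Ω ℓ c}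
def ipConst {n : ℕ} (Ω : Set (E n)) (ℓ : ℕ) : ℝ := sInf {c : ℝ | 0 < c ∧ IPWith Ω ℓ c}

end FormIneq

end

/-! Test forms φ are sent to the pairs (dφ, d*φ) in a Hilbert sum of two L₂ spaces (`pairMap`). The
closure K of the range consists of the pairs (dw, d*w) with w in H₀¹, M is the closure of the range
of d*, and u, v are conjugate exactly when (-v, u) is orthogonal to K. The equality C = 1 + Γ is
then Hilbert space geometry. If d*w = u, then ‖u‖² = ⟨u, d*w⟩ = ⟨v, dw⟩, while ‖dw‖² ≤ (C - 1)‖u‖²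
(`conjugate_bound_of_preimage`). Conversely, the residual of projecting (0, u) to K is a conjugate
pair, so Friedrichs–Velte bounds the projection from below on M (`norm_sq_le_projection`), and by
duality w ↦ d*w maps onto M with norm control (`exists_preimage_of_conjugate_bound`).

The energy identity `energy_eq` transfers the scalar Hardy inequality to forms with the same
constant (`hardy_testForms`). Hence φ ↦ ⟨u, d*φ⟩ = ⟨ρ du, φ/ρ⟩ is bounded by √H ‖ρ du‖ |φ|₁, and
evaluating its extension at a Babuška–Aziz solution of d*w = u gives P ≤ H C (`IPWith.of_BAWith`).

The bound Γ ≤ 4P rests on ‖ρ du‖ ≤ 2‖v‖ for conjugate u, v (`abs_inner_codL2_le`), an estimate of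
Caccioppoli type. Formally, testing with ρ² du gives ‖ρ du‖² = ⟨v, 2ρ dρ ∧ du⟩ ≤ 2‖v‖ ‖ρ du‖,
because d(du) = 0 and |dρ| ≤ 1. To justify this, u is mollified and ρ is replaced by a smooth
compactly supported χ with |dχ| ≤ 1 and χ ≥ θρ on a given compact set; then θ tends to 1. -/

noncomputable section

namespace FormIneq

/-! ### Sign rules of the exterior algebra in coordinates. -/

section Signs

variable {n : ℕ}

theorem wedgeSign_insert {i : Fin n} {J : Finset (Fin n)} (h : i ∉ J) :
    wedgeSign i J (insert i J) = (-1) ^ (J.filter (· < i)).card := by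
  simp [wedgeSign, h]

theorem wedgeSign_of_mem {i : Fin n} {J I : Finset (Fin n)} (h : i ∈ J) :
    wedgeSign i J I = 0 := by
  simp [wedgeSign, h]

theorem wedgeSign_of_ne {i : Fin n} {J I : Finset (Fin n)} (h : I ≠ insert i J) :
    wedgeSign i J I = 0 := by
  simp [wedgeSign, h]

theorem sum_wedgeSign_right {p r : ℕ} (hr : p + 1 = r) (i : Fin n) (J : MIdx n p)
    (g : Finset (Fin n) → ℝ) :
    ∑ I : MIdx n r, wedgeSign i J.1 I.1 * g I.1 =
      wedgeSign i J.1 (insert i J.1) * g (insert i J.1) := by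
  by_cases h : i ∈ J.1
  · simp [wedgeSign_of_mem h]
  · rw [Finset.sum_eq_single ⟨insert i J.1, by rw [Finset.card_insert_of_notMem h, J.2, hr]⟩]
    · intro I _ hI
      rw [wedgeSign_of_ne, zero_mul]
      exact fun h' => hI (Subtype.ext h')
    · simp

theorem sum_wedgeSign_left {p q : ℕ} (hq : q + 1 = p) (i : Fin n) (J : MIdx n p)
    (g : Finset (Fin n) → ℝ) :
    ∑ K : MIdx n q, wedgeSign i K.1 J.1 * g K.1 =
      wedgeSign i (J.1.erase i) J.1 * g (J.1.erase i) := by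
  by_cases h : i ∈ J.1
  · rw [Finset.sum_eq_single ⟨J.1.erase i, by
      rw [Finset.card_erase_of_mem h, J.2, ← hq, Nat.add_sub_cancel]⟩]
    · intro K _ hK
      by_cases hiK : i ∈ K.1
      · rw [wedgeSign_of_mem hiK, zero_mul]
      · rw [wedgeSign_of_ne, zero_mul]
        intro h'
        exact hK (Subtype.ext (by simp [h', Finset.erase_insert hiK]))
    · simp
  · have : ∀ K, wedgeSign i K J.1 = 0 := fun K =>
      wedgeSign_of_ne fun h' => h (h' ▸ Finset.mem_insert_self i K)
    simp [this]

/-- The sign changes precisely when i < j. Of i < j and j < i exactly one holds for distinct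
indices, which is the source of anticommutation. -/
theorem card_filter_insert {i j : Fin n} {J : Finset (Fin n)} (h : i ∉ J) :
    ((-1 : ℝ)) ^ ((insert i J).filter (· < j)).card =
      (if i < j then -1 else 1) * (-1) ^ (J.filter (· < j)).card := by
  rw [Finset.filter_insert]
  split_ifs
  · rw [Finset.card_insert_of_notMem (by simp [h]), pow_succ, mul_comm]
  · simp

theorem neg_one_pow_mul_self (k : ℕ) : (-1 : ℝ) ^ k * (-1) ^ k = 1 := by
  rw [← mul_pow]; simp

/-- The anticommutation relation between exterior and interior multiplication. -/
theorem wedgeSign_anticomm {p q r : ℕ} (hq : q + 1 = p) (hr : p + 1 = r) (i j : Fin n)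
    (J L : MIdx n p) :
    ∑ I : MIdx n r, wedgeSign i J.1 I.1 * wedgeSign j L.1 I.1 +
      ∑ K : MIdx n q, wedgeSign j K.1 J.1 * wedgeSign i K.1 L.1 =
      if i = j ∧ J = L then 1 else 0 := by
  rw [sum_wedgeSign_right hr i J (fun I => wedgeSign j L.1 I),
    sum_wedgeSign_left hq j J (fun K => wedgeSign i K L.1)]
  obtain ⟨J, hJ⟩ := J
  obtain ⟨L, hL⟩ := L
  simp only [Subtype.mk.injEq]
  by_cases hij : i = j
  · subst hij
    by_cases hi : i ∈ J
    · obtain ⟨K, hK, rfl⟩ : ∃ K, i ∉ K ∧ insert i K = J :=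
        ⟨J.erase i, Finset.notMem_erase _ _, Finset.insert_erase hi⟩
      rw [wedgeSign_of_mem hi, Finset.erase_insert hK, wedgeSign_insert hK]
      by_cases hL' : insert i K = L
      · subst hL'
        simp [wedgeSign_insert hK, neg_one_pow_mul_self]
      · simp [wedgeSign_of_ne (Ne.symm hL'), hL']
    · have h0 : wedgeSign i (J.erase i) J = 0 := wedgeSign_of_ne fun h' =>
        hi (h' ▸ Finset.mem_insert_self _ _)
      rw [h0, zero_mul, add_zero]
      by_cases hiL : i ∈ L
      · rw [wedgeSign_of_mem hiL, mul_zero, if_neg]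
        rintro ⟨-, rfl⟩
        exact hi hiL
      · by_cases hJL : J = L
        · subst hJL
          simp [wedgeSign_insert hi, neg_one_pow_mul_self]
        · rw [wedgeSign_of_ne (i := i) (J := L), mul_zero, if_neg (by simp [hJL])]
          intro h'
          apply hJL
          rw [← Finset.erase_insert hi, h', Finset.erase_insert hiL]
  · rw [if_neg (by simp [hij])]
    -- For i ≠ j both products are nonzero only for this configuration of J and L, where they
    -- cancel; otherwise each vanishes.
    by_cases hc : i ∉ J ∧ j ∈ J ∧ L = insert i (J.erase j)
    · obtain ⟨hi, hj, rfl⟩ := hc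
      obtain ⟨K, hK, rfl⟩ : ∃ K, j ∉ K ∧ insert j K = J :=
        ⟨J.erase j, Finset.notMem_erase _ _, Finset.insert_erase hj⟩
      rw [Finset.erase_insert hK]
      have hiK : i ∉ K := fun h => hi (Finset.mem_insert_of_mem h)
      have hjK : j ∉ insert i K := by simp [hK, Ne.symm hij]
      rw [wedgeSign_insert hi, Finset.insert_comm, wedgeSign_insert hjK, wedgeSign_insert hK,
        wedgeSign_insert hiK, card_filter_insert hK, card_filter_insert hiK]
      rcases lt_or_gt_of_ne hij with h | h
      · simp [h, h.not_gt]; ring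
      · simp [h, h.not_gt]; ring
    · have h1 : wedgeSign i J (insert i J) * wedgeSign j L (insert i J) = 0 := by
        by_contra hne
        have hi : i ∉ J := fun h => hne (by rw [wedgeSign_of_mem h, zero_mul])
        have hj : j ∉ L := fun h => hne (by rw [wedgeSign_of_mem h, mul_zero])
        have he : insert i J = insert j L := by
          by_contra h; exact hne (by rw [wedgeSign_of_ne h, mul_zero])
        refine hc ⟨hi, ?_, ?_⟩
        · have : j ∈ insert i J := he ▸ Finset.mem_insert_self _ _
          exact (Finset.mem_insert.1 this).resolve_left (Ne.symm hij)
        · rw [← Finset.erase_insert hj, ← he, Finset.erase_insert_of_ne hij]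
      have h2 : wedgeSign j (J.erase j) J * wedgeSign i (J.erase j) L = 0 := by
        by_contra hne
        have hj : j ∈ J := by
          by_contra h
          have h0 : wedgeSign j (J.erase j) J = 0 :=
            wedgeSign_of_ne fun h' => h (h' ▸ Finset.mem_insert_self _ _)
          exact hne (by rw [h0, zero_mul])
        have hi : i ∉ J.erase j := fun h => hne (by rw [wedgeSign_of_mem h, mul_zero])
        have he : L = insert i (J.erase j) := by
          by_contra h; exact hne (by rw [wedgeSign_of_ne h, mul_zero])
        exact hc ⟨fun h => hi (Finset.mem_erase.2 ⟨hij, h⟩), hj, he⟩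
      rw [h1, h2, add_zero]

/-- Exterior multiplications by two covectors anticommute. -/
theorem wedgeSign_comp_anticomm {p q r : ℕ} (hq : p + 1 = q) (i j : Fin n)
    (K : MIdx n p) (I : MIdx n r) :
    ∑ J : MIdx n q, wedgeSign i K.1 J.1 * wedgeSign j J.1 I.1 +
      ∑ J : MIdx n q, wedgeSign j K.1 J.1 * wedgeSign i J.1 I.1 = 0 := by
  rw [sum_wedgeSign_right hq i K (fun J => wedgeSign j J I.1),
    sum_wedgeSign_right hq j K (fun J => wedgeSign i J I.1)]
  obtain ⟨K, hK⟩ := K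
  obtain ⟨I, hI⟩ := I
  dsimp only
  by_cases hi : i ∈ K
  · simp [wedgeSign_of_mem hi, wedgeSign_of_mem (Finset.mem_insert_of_mem hi)]
  by_cases hj : j ∈ K
  · simp [wedgeSign_of_mem hj, wedgeSign_of_mem (Finset.mem_insert_of_mem hj)]
  by_cases hij : i = j
  · subst hij
    simp [wedgeSign_of_mem (Finset.mem_insert_self i K)]
  have h1 : j ∉ insert i K := by simp [hj, Ne.symm hij]
  have h2 : i ∉ insert j K := by simp [hi, hij]
  by_cases hI : I = insert j (insert i K)
  · subst hI
    rw [wedgeSign_insert hi, wedgeSign_insert h1, wedgeSign_insert hj, Finset.insert_comm,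
      wedgeSign_insert h2, card_filter_insert hj, card_filter_insert hi]
    rcases lt_or_gt_of_ne hij with h | h
    · simp [h, h.not_gt]; ring
    · simp [h, h.not_gt]; ring
  · rw [wedgeSign_of_ne hI, wedgeSign_of_ne (i := i) (J := insert j K)]
    · simp
    · rwa [Finset.insert_comm]

end Signs

/-! ### Symbols of d and d*, and the pointwise wedge estimate. -/

section Pointwise

variable {n : ℕ}

/-- Anticommutation summed against S, whose symmetry in the two derivative indices leaves only the
diagonal. It is applied to products at a point, with S from a rank-one derivative, and to integrals,
where the symmetry comes from integration by parts. -/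
theorem wedge_contract_sum {p q r : ℕ} (hq : q + 1 = p) (hr : p + 1 = r)
    (S : Fin n → MIdx n p → Fin n → MIdx n p → ℝ) (hS : ∀ i J j L, S i J j L = S j J i L) :
    ∑ I : MIdx n r, ∑ i, ∑ J : MIdx n p, ∑ j, ∑ L : MIdx n p,
        wedgeSign i J.1 I.1 * wedgeSign j L.1 I.1 * S i J j L +
      ∑ K : MIdx n q, ∑ i, ∑ J : MIdx n p, ∑ j, ∑ L : MIdx n p,
        wedgeSign i K.1 J.1 * wedgeSign j K.1 L.1 * S i J j L =
      ∑ i, ∑ J : MIdx n p, S i J i J := by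
  have e1 : ∑ I : MIdx n r, ∑ i, ∑ J : MIdx n p, ∑ j, ∑ L : MIdx n p,
        wedgeSign i J.1 I.1 * wedgeSign j L.1 I.1 * S i J j L =
      ∑ i, ∑ J : MIdx n p, ∑ j, ∑ L : MIdx n p,
        (∑ I : MIdx n r, wedgeSign i J.1 I.1 * wedgeSign j L.1 I.1) * S i J j L := by
    simp only [Finset.sum_mul]
    rw [Finset.sum_comm]; refine Finset.sum_congr rfl fun i _ => ?_
    rw [Finset.sum_comm]; refine Finset.sum_congr rfl fun J _ => ?_
    rw [Finset.sum_comm]; refine Finset.sum_congr rfl fun j _ => ?_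
    rw [Finset.sum_comm]
  have e2 : ∑ K : MIdx n q, ∑ i, ∑ J : MIdx n p, ∑ j, ∑ L : MIdx n p,
        wedgeSign i K.1 J.1 * wedgeSign j K.1 L.1 * S i J j L =
      ∑ i, ∑ J : MIdx n p, ∑ j, ∑ L : MIdx n p,
        (∑ K : MIdx n q, wedgeSign j K.1 J.1 * wedgeSign i K.1 L.1) * S i J j L := by
    -- The contraction term in `wedgeSign_anticomm` pairs j with J, the squared norm pairs i with J;
    -- the symmetry of S makes the exchange harmless.
    have : ∀ i (J : MIdx n p) j (L : MIdx n p),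
        (∑ K : MIdx n q, wedgeSign j K.1 J.1 * wedgeSign i K.1 L.1) * S i J j L =
        ∑ K : MIdx n q, wedgeSign j K.1 J.1 * wedgeSign i K.1 L.1 * S j J i L :=
      fun i J j L => by rw [hS, Finset.sum_mul]
    simp only [this]
    have h3 : ∀ f : Fin n → MIdx n p → Fin n → MIdx n p → ℝ,
        ∑ i, ∑ J, ∑ j, ∑ L, f i J j L = ∑ i, ∑ J, ∑ j, ∑ L, f j J i L := by
      intro f
      calc ∑ i, ∑ J, ∑ j, ∑ L, f i J j L = ∑ i, ∑ j, ∑ J, ∑ L, f i J j L :=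
            Finset.sum_congr rfl fun i _ => Finset.sum_comm
        _ = ∑ j, ∑ i, ∑ J, ∑ L, f i J j L := Finset.sum_comm
        _ = _ := Finset.sum_congr rfl fun i _ => Finset.sum_comm
    rw [h3 fun i J j L => ∑ K : MIdx n q, wedgeSign j K.1 J.1 * wedgeSign i K.1 L.1 * S j J i L,
      Finset.sum_comm]
    refine Finset.sum_congr rfl fun i _ => ?_
    rw [Finset.sum_comm]; refine Finset.sum_congr rfl fun J _ => ?_
    rw [Finset.sum_comm]; refine Finset.sum_congr rfl fun j _ => ?_
    rw [Finset.sum_comm]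
  rw [e1, e2]
  simp only [← Finset.sum_add_distrib, ← add_mul, wedgeSign_anticomm hq hr]
  refine Finset.sum_congr rfl fun i _ => Finset.sum_congr rfl fun J _ => ?_
  rw [Finset.sum_eq_single i, Finset.sum_eq_single J]
  · simp
  · intro L _ hL
    simp [Ne.symm hL]
  · simp
  · intro j _ hj
    simp [Ne.symm hj]
  · simp

/-- The `i`-th basis vector. -/
abbrev stdVec (i : Fin n) : E n := EuclideanSpace.single i (1 : ℝ)

/-- The symbol of `d`, applied to a derivative, with values in `Λ^r`. -/
def wedgeL (n p r : ℕ) : (E n →L[ℝ] Form n p) →L[ℝ] Form n r :=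
  LinearMap.toContinuousLinearMap
    { toFun := fun A => WithLp.toLp 2 fun I => ∑ i : Fin n, ∑ J : MIdx n p,
        wedgeSign i J.1 I.1 * A (stdVec i) J
      map_add' := fun A B => by
        ext I
        simp [mul_add, Finset.sum_add_distrib]
      map_smul' := fun c A => by
        ext I
        simp [Finset.mul_sum, mul_left_comm] }

/-- The symbol of `d*`, applied to a derivative, with values in `Λ^q`. -/
def contrL (n p q : ℕ) : (E n →L[ℝ] Form n p) →L[ℝ] Form n q :=
  LinearMap.toContinuousLinearMap
    { toFun := fun A => WithLp.toLp 2 fun K => -∑ i : Fin n, ∑ I : MIdx n p,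
        wedgeSign i K.1 I.1 * A (stdVec i) I
      map_add' := fun A B => by
        ext I
        simp [mul_add, Finset.sum_add_distrib]
        ring
      map_smul' := fun c A => by
        ext I
        simp [Finset.mul_sum, mul_left_comm] }

theorem wedgeL_apply {p r : ℕ} (A : E n →L[ℝ] Form n p) (I : MIdx n r) :
    wedgeL n p r A I = ∑ i : Fin n, ∑ J : MIdx n p, wedgeSign i J.1 I.1 * A (stdVec i) J := rfl

theorem contrL_apply {p q : ℕ} (A : E n →L[ℝ] Form n p) (K : MIdx n q) :
    contrL n p q A K = -∑ i : Fin n, ∑ I : MIdx n p, wedgeSign i K.1 I.1 * A (stdVec i) I := rfl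

theorem extD_eq {p : ℕ} (φ : E n → Form n p) (x : E n) :
    extD φ x = wedgeL n p (p + 1) (fderiv ℝ φ x) := rfl

theorem codiff_eq {p : ℕ} (φ : E n → Form n p) (x : E n) :
    codiff φ x = contrL n p (p - 1) (fderiv ℝ φ x) := rfl

theorem sq_wedgeL {p r : ℕ} (A : E n →L[ℝ] Form n p) (I : MIdx n r) :
    (wedgeL n p r A I) ^ 2 = ∑ i, ∑ J : MIdx n p, ∑ j, ∑ L : MIdx n p,
      wedgeSign i J.1 I.1 * wedgeSign j L.1 I.1 * (A (stdVec i) J * A (stdVec j) L) := by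
  rw [wedgeL_apply, sq, Finset.sum_mul]
  refine Finset.sum_congr rfl fun i _ => ?_
  rw [Finset.sum_mul]
  refine Finset.sum_congr rfl fun J _ => ?_
  rw [Finset.mul_sum]
  refine Finset.sum_congr rfl fun j _ => ?_
  rw [Finset.mul_sum]
  exact Finset.sum_congr rfl fun L _ => by ring

theorem sq_contrL {p q : ℕ} (A : E n →L[ℝ] Form n p) (K : MIdx n q) :
    (contrL n p q A K) ^ 2 = ∑ i, ∑ J : MIdx n p, ∑ j, ∑ L : MIdx n p,
      wedgeSign i K.1 J.1 * wedgeSign j K.1 L.1 * (A (stdVec i) J * A (stdVec j) L) := by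
  rw [contrL_apply, neg_sq, sq, Finset.sum_mul]
  refine Finset.sum_congr rfl fun i _ => ?_
  rw [Finset.sum_mul]
  refine Finset.sum_congr rfl fun J _ => ?_
  rw [Finset.mul_sum]
  refine Finset.sum_congr rfl fun j _ => ?_
  rw [Finset.mul_sum]
  exact Finset.sum_congr rfl fun L _ => by ring

theorem norm_sq_eq_sum {ι : Type*} [Fintype ι] (x : EuclideanSpace ℝ ι) :
    ‖x‖ ^ 2 = ∑ i, x i ^ 2 := by
  simp [EuclideanSpace.norm_sq_eq]

theorem sum_apply_stdVec (a : E n →L[ℝ] ℝ) : ∑ i, a (stdVec i) ^ 2 = ‖a‖ ^ 2 := by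
  rw [← (InnerProductSpace.toDual ℝ (E n)).symm.norm_map a, norm_sq_eq_sum]
  refine Finset.sum_congr rfl fun i _ => ?_
  rw [← InnerProductSpace.toDual_symm_apply, EuclideanSpace.inner_single_right]
  simp

/-- `|a ∧ f| ≤ |a| |f|` for a covector `a`. -/
theorem norm_wedgeL_smulRight_le {p q r : ℕ} (hq : q + 1 = p) (hr : p + 1 = r)
    (a : E n →L[ℝ] ℝ) (f : Form n p) : ‖wedgeL n p r (a.smulRight f)‖ ≤ ‖a‖ * ‖f‖ := by
  refine (sq_le_sq₀ (norm_nonneg _) (by positivity)).1 ?_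
  -- For the rank-one map a ⊗ f this reads |a ∧ f|² + |a ⌟ f|² = |a|²|f|².
  have h := wedge_contract_sum hq hr
    (fun i J j L => (a.smulRight f) (stdVec i) J * (a.smulRight f) (stdVec j) L)
    (fun i J j L => by simp; ring)
  simp only [← sq_wedgeL, ← sq_contrL] at h
  have h2 : ∑ i, ∑ J : MIdx n p, (a.smulRight f) (stdVec i) J * (a.smulRight f) (stdVec i) J =
      (‖a‖ * ‖f‖) ^ 2 := by
    rw [mul_pow, ← sum_apply_stdVec, norm_sq_eq_sum f, Finset.sum_mul_sum]
    refine Finset.sum_congr rfl fun i _ => Finset.sum_congr rfl fun J _ => ?_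
    simp; ring
  rw [norm_sq_eq_sum, ← h2, ← h]
  exact le_add_of_nonneg_right (Finset.sum_nonneg fun _ _ => sq_nonneg _)

end Pointwise

/-! ### Abstract duality between a pair of operators D and S. -/

section Hilbert

variable {V X Y Z : Type*} [AddCommGroup V] [Module ℝ V]
  [NormedAddCommGroup X] [InnerProductSpace ℝ X]
  [NormedAddCommGroup Y] [InnerProductSpace ℝ Y]
  [NormedAddCommGroup Z]

/-- A functional that is bounded by `‖T v‖` is represented on the range of `T`. -/
theorem exists_inner_eq_of_bound [CompleteSpace X] (T : V →ₗ[ℝ] X) (F : V →ₗ[ℝ] ℝ) {C : ℝ}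
    (hC : 0 ≤ C) (h : ∀ v, |F v| ≤ C * ‖T v‖) :
    ∃ g : X, ‖g‖ ≤ C ∧ ∀ v, inner ℝ g (T v) = F v := by
  obtain ⟨s, hs⟩ := T.rangeRestrict.exists_rightInverse_of_surjective T.range_rangeRestrict
  have hTs : ∀ y : LinearMap.range T, T (s y) = y := fun y =>
    congrArg Subtype.val (LinearMap.congr_fun hs y)
  -- The bound forces F to vanish on the kernel of T, so the choice of the linear section s is
  -- immaterial.
  have hFT : ∀ v, F (s ⟨T v, v, rfl⟩) = F v := by
    intro v
    have h1 := h (s ⟨T v, v, rfl⟩ - v)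
    rw [map_sub, map_sub, hTs, sub_self, norm_zero, mul_zero] at h1
    exact sub_eq_zero.1 (abs_eq_zero.1 (le_antisymm h1 (abs_nonneg _)))
  let G : StrongDual ℝ (LinearMap.range T) := (F.comp s).mkContinuous C fun y => by
    have := h (s y)
    rwa [hTs] at this
  -- The range of T need not be closed: Hahn–Banach extends G to all of X without increasing its
  -- norm, and Riesz represents it.
  obtain ⟨g, hg, hgn⟩ := exists_extension_norm_eq (LinearMap.range T) G
  refine ⟨(InnerProductSpace.toDual ℝ X).symm g, ?_, fun v => ?_⟩
  · rw [LinearIsometryEquiv.norm_map, hgn]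
    exact LinearMap.mkContinuous_norm_le _ hC _
  · rw [InnerProductSpace.toDual_symm_apply]
    exact (hg ⟨T v, v, rfl⟩).trans (hFT v)

/-- The graph map `φ ↦ (Dφ, Sφ)` into the Hilbert sum. -/
def pairMap (D : V →ₗ[ℝ] X) (S : V →ₗ[ℝ] Y) : V →ₗ[ℝ] WithLp 2 (X × Y) :=
  (WithLp.linearEquiv 2 ℝ (X × Y)).symm.toLinearMap ∘ₗ D.prod S

variable (D : V →ₗ[ℝ] X) (S : V →ₗ[ℝ] Y)

theorem mem_orthogonal_range_iff {u : X} :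
    u ∈ (LinearMap.range D)ᗮ ↔ ∀ φ, inner ℝ u (D φ) = 0 := by
  rw [Submodule.mem_orthogonal']
  simp

theorem mem_orthogonal_range_pairMap {z : WithLp 2 (X × Y)} :
    z ∈ (LinearMap.range (pairMap D S))ᗮ ↔
      ∀ φ, inner ℝ z.fst (D φ) + inner ℝ z.snd (S φ) = 0 := by
  rw [mem_orthogonal_range_iff]
  rfl

/-- Conjugacy says that (-v, u) is orthogonal to the range of `pairMap`, hence also to its double
orthogonal. This extends the weak identity from test forms to H₀¹. -/
theorem inner_snd_eq_inner_fst {u : Y} {v : X} (h : ∀ φ, inner ℝ u (S φ) = inner ℝ v (D φ))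
    {k : WithLp 2 (X × Y)} (hk : k ∈ (LinearMap.range (pairMap D S))ᗮᗮ) :
    inner ℝ u k.snd = inner ℝ v k.fst := by
  have hz : WithLp.toLp 2 (-v, u) ∈ (LinearMap.range (pairMap D S))ᗮ := by
    rw [mem_orthogonal_range_pairMap]
    intro φ
    simp [h]
  have := (Submodule.mem_orthogonal _ _).1 hk _ hz
  rw [WithLp.prod_inner_apply] at this
  simp only [inner_neg_left] at this
  exact eq_of_sub_eq_zero ((neg_add_eq_sub _ _).symm.trans this)

/-- The case v = 0 of the previous lemma; concretely, d*w lies in M. -/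
theorem snd_mem_orthogonal_orthogonal {k : WithLp 2 (X × Y)}
    (hk : k ∈ (LinearMap.range (pairMap D S))ᗮᗮ) : k.snd ∈ (LinearMap.range S)ᗮᗮ := by
  rw [Submodule.mem_orthogonal]
  intro v hv
  rw [mem_orthogonal_range_iff] at hv
  have := inner_snd_eq_inner_fst D S (u := v) (v := 0) (fun φ => by simp [hv]) hk
  simpa using this

instance hasOrthogonalProjection_orthogonal_orthogonal [CompleteSpace X] (U : Submodule ℝ X) :
    Uᗮᗮ.HasOrthogonalProjection :=
  haveI : CompleteSpace Uᗮᗮ := (Submodule.isClosed_orthogonal Uᗮ).completeSpace_coe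
  Submodule.HasOrthogonalProjection.ofCompleteSpace _

/-- The lower bound for `S` on the orthogonal complement of the conjugate pairs. -/
theorem norm_sq_le_projection [CompleteSpace X] [CompleteSpace Y] {γ : ℝ} (hγ : 0 ≤ γ)
    (h : ∀ u ∈ (LinearMap.range S)ᗮᗮ, ∀ v : X,
      (∀ φ, inner ℝ u (S φ) = inner ℝ v (D φ)) → ‖u‖ ^ 2 ≤ γ * ‖v‖ ^ 2)
    {u : Y} (hu : u ∈ (LinearMap.range S)ᗮᗮ) :
    ‖u‖ ^ 2 ≤ (1 + γ) *
      ‖(LinearMap.range (pairMap D S))ᗮᗮ.starProjection (WithLp.toLp 2 ((0 : X), u))‖ ^ 2 := by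
  set K := (LinearMap.range (pairMap D S))ᗮᗮ with hK
  set w := K.starProjection (WithLp.toLp 2 ((0 : X), u)) with hw
  have hwK : w ∈ K := Submodule.starProjection_apply_mem _ _
  have hz : WithLp.toLp 2 ((0 : X), u) - w ∈ Kᗮ := Submodule.sub_starProjection_mem_orthogonal _
  have hz' : WithLp.toLp 2 ((0 : X), u) - w ∈ (LinearMap.range (pairMap D S))ᗮ := by
    rwa [hK, Submodule.triorthogonal_eq_orthogonal] at hz
  have hq := (mem_orthogonal_range_pairMap D S).1 hz'
  have hzw := (Submodule.mem_orthogonal' _ _).1 hz w hwK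
  rw [WithLp.prod_inner_apply] at hzw
  change inner ℝ (0 - w.fst) w.fst + inner ℝ (u - w.snd) w.snd = 0 at hzw
  replace hq : ∀ φ, inner ℝ (0 - w.fst) (D φ) + inner ℝ (u - w.snd) (S φ) = 0 := hq
  simp only [zero_sub, inner_neg_left, real_inner_self_eq_norm_sq] at hzw hq
  have hqM : u - w.snd ∈ (LinearMap.range S)ᗮᗮ :=
    Submodule.sub_mem _ hu (snd_mem_orthogonal_orthogonal D S hwK)
  -- The residual (-w.fst, u - w.snd) is orthogonal to the range, so u - w.snd and w.fst are
  -- conjugate.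
  have hfv := h _ hqM w.fst fun φ => by linarith [hq φ]
  have hexp : ‖u‖ ^ 2 = ‖u - w.snd‖ ^ 2 + 2 * inner ℝ (u - w.snd) w.snd + ‖w.snd‖ ^ 2 := by
    rw [← norm_add_sq_real, sub_add_cancel]
  have hcs := real_inner_le_norm (u - w.snd) w.snd
  -- The residual is also orthogonal to w itself, so ‖w.fst‖² = ⟨u - w.snd, w.snd⟩; combine
  -- Cauchy–Schwarz with `hfv`.
  have hle : ‖w.fst‖ ^ 2 ≤ γ * ‖w.snd‖ ^ 2 := by
    rcases (norm_nonneg w.fst).eq_or_lt with h0 | h0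
    · simpa [← h0] using mul_nonneg hγ (sq_nonneg ‖w.snd‖)
    · have h1 : ‖w.fst‖ ^ 2 ≤ ‖u - w.snd‖ * ‖w.snd‖ := by linarith
      have h2 : (‖w.fst‖ ^ 2) ^ 2 ≤ (‖u - w.snd‖ * ‖w.snd‖) ^ 2 :=
        pow_le_pow_left₀ (by positivity) h1 2
      have h3 : (‖u - w.snd‖ * ‖w.snd‖) ^ 2 ≤ γ * ‖w.fst‖ ^ 2 * ‖w.snd‖ ^ 2 := by
        rw [mul_pow]; gcongr
      refine le_of_mul_le_mul_left ?_ (pow_pos h0 2)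
      linarith
  -- In `hexp` the cross term is 2‖w.fst‖²; one copy is kept and the other is bounded by γ‖w.snd‖²,
  -- giving (1 + γ)(‖w.fst‖² + ‖w.snd‖²).
  rw [WithLp.prod_norm_sq_eq_of_L2]
  linarith

/-- The map u' ↦ P(0, u') from M to K is bounded below, and its adjoint is k ↦ k.snd, which is
therefore onto M. The preimage is the projection of the vector representing P(0, u') ↦ ⟨u, u'⟩. -/
theorem exists_preimage_of_conjugate_bound [CompleteSpace X] [CompleteSpace Y] {γ : ℝ} (hγ : 0 ≤ γ)
    (h : ∀ u ∈ (LinearMap.range S)ᗮᗮ, ∀ v : X,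
      (∀ φ, inner ℝ u (S φ) = inner ℝ v (D φ)) → ‖u‖ ^ 2 ≤ γ * ‖v‖ ^ 2)
    {u : Y} (hu : u ∈ (LinearMap.range S)ᗮᗮ) :
    ∃ k ∈ (LinearMap.range (pairMap D S))ᗮᗮ, k.snd = u ∧
      ‖k.fst‖ ^ 2 + ‖k.snd‖ ^ 2 ≤ (1 + γ) * ‖u‖ ^ 2 := by
  set K := (LinearMap.range (pairMap D S))ᗮᗮ with hK
  let M := (LinearMap.range S)ᗮᗮ
  let emb : M →ₗ[ℝ] WithLp 2 (X × Y) :=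
    (WithLp.linearEquiv 2 ℝ (X × Y)).symm.toLinearMap ∘ₗ
      LinearMap.inr ℝ X Y ∘ₗ M.subtype
  obtain ⟨g, hg, hgu⟩ := exists_inner_eq_of_bound (K.starProjection.toLinearMap ∘ₗ emb)
    ((innerSL ℝ u).toLinearMap ∘ₗ M.subtype) (C := √(1 + γ) * ‖u‖) (by positivity) (by
      intro u'
      have h1 := norm_sq_le_projection D S hγ h u'.2
      have h2 : ‖(u' : Y)‖ ≤
          √(1 + γ) * ‖K.starProjection (WithLp.toLp 2 ((0 : X), (u' : Y)))‖ := by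
        refine (sq_le_sq₀ (norm_nonneg _) (by positivity)).1 ?_
        rwa [mul_pow, Real.sq_sqrt (by positivity)]
      calc |inner ℝ u (u' : Y)| ≤ ‖u‖ * ‖(u' : Y)‖ := abs_real_inner_le_norm _ _
        _ ≤ ‖u‖ * (√(1 + γ) * ‖K.starProjection (WithLp.toLp 2 ((0 : X), (u' : Y)))‖) := by gcongr
        _ = √(1 + γ) * ‖u‖ * ‖K.starProjection (WithLp.toLp 2 ((0 : X), (u' : Y)))‖ := by ring)
  refine ⟨K.starProjection g, Submodule.starProjection_apply_mem _ _, ?_, ?_⟩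
  -- The defect lies in M, and testing the representation with the defect itself shows that it is
  -- zero.
  · have hm : (K.starProjection g).snd - u ∈ M :=
      Submodule.sub_mem _
        (snd_mem_orthogonal_orthogonal D S (Submodule.starProjection_apply_mem _ _)) hu
    have h1 := hgu ⟨_, hm⟩
    change inner ℝ g (K.starProjection (WithLp.toLp 2 ((0 : X), (K.starProjection g).snd - u))) =
      inner ℝ u ((K.starProjection g).snd - u) at h1
    rw [← Submodule.inner_starProjection_left_eq_right, WithLp.prod_inner_apply] at h1
    simp only [inner_zero_right, zero_add] at h1
    rw [← sub_eq_zero, ← inner_self_eq_zero (𝕜 := ℝ), inner_sub_left]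
    exact sub_eq_zero.2 h1
  · rw [← WithLp.prod_norm_sq_eq_of_L2]
    have h1 : ‖K.starProjection g‖ ≤ √(1 + γ) * ‖u‖ :=
      (Submodule.norm_starProjection_apply_le _ _).trans hg
    calc ‖K.starProjection g‖ ^ 2 ≤ (√(1 + γ) * ‖u‖) ^ 2 := by gcongr
      _ = _ := by rw [mul_pow, Real.sq_sqrt (by positivity)]

/-- Here ‖u‖² = ⟨u, k.snd⟩ = ⟨v, k.fst⟩. The constant is c - 1 because k.snd = u already uses ‖u‖²
of the budget c‖u‖². -/
theorem conjugate_bound_of_preimage {c : ℝ} (hc : 1 ≤ c)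
    {u : Y} {v : X} (huv : ∀ φ, inner ℝ u (S φ) = inner ℝ v (D φ))
    {k : WithLp 2 (X × Y)} (hk : k ∈ (LinearMap.range (pairMap D S))ᗮᗮ) (hku : k.snd = u)
    (hkn : ‖k.fst‖ ^ 2 + ‖k.snd‖ ^ 2 ≤ c * ‖u‖ ^ 2) :
    ‖u‖ ^ 2 ≤ (c - 1) * ‖v‖ ^ 2 := by
  rcases (norm_nonneg u).eq_or_lt with h0 | h0
  · rw [← h0]
    simpa using mul_nonneg (sub_nonneg.2 hc) (sq_nonneg ‖v‖)
  · have h1 := inner_snd_eq_inner_fst D S huv hk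
    rw [hku, real_inner_self_eq_norm_sq] at h1
    rw [hku] at hkn
    have h2 : ‖u‖ ^ 2 ≤ ‖v‖ * ‖k.fst‖ := h1 ▸ real_inner_le_norm _ _
    have h3 : (‖u‖ ^ 2) ^ 2 ≤ (‖v‖ * ‖k.fst‖) ^ 2 := pow_le_pow_left₀ (by positivity) h2 2
    have h4 : (‖v‖ * ‖k.fst‖) ^ 2 ≤ ‖v‖ ^ 2 * ((c - 1) * ‖u‖ ^ 2) := by
      rw [mul_pow]; gcongr; linarith
    refine le_of_mul_le_mul_left ?_ (pow_pos h0 2)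
    linarith

/-- The double orthogonal is closed and contains every (Dφ, Sφ); thus an element of `H01Form` yields
an element of K. -/
theorem mem_orthogonal_orthogonal_of_mem_closure [NormedSpace ℝ Z] {A : V →ₗ[ℝ] Z} {t : Z × X × Y}
    (ht : t ∈ closure (range fun φ => (A φ, D φ, S φ))) :
    WithLp.toLp 2 (t.2.1, t.2.2) ∈ (LinearMap.range (pairMap D S))ᗮᗮ := by
  have hc : Continuous fun t : Z × X × Y => (WithLp.toLp 2 (t.2.1, t.2.2) : WithLp 2 (X × Y)) := by
    fun_prop
  have hcl := (Submodule.isClosed_orthogonal (LinearMap.range (pairMap D S))ᗮ).preimage hc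
  refine closure_minimal ?_ hcl ht
  rintro _ ⟨φ, rfl⟩
  exact Submodule.le_orthogonal_orthogonal _ ⟨φ, rfl⟩

/-- Given (Dφ, Sφ) converging to k, the coercivity `hA` makes Aφ Cauchy as well. With the Poincaré
inequality for `hA`, each element of K comes from an element of `H01Form`. -/
theorem exists_mem_closure_of_mem_orthogonal_orthogonal [CompleteSpace X] [CompleteSpace Y]
    [CompleteSpace Z] [NormedSpace ℝ Z] (A : V →ₗ[ℝ] Z) {C : ℝ} (hC : 0 ≤ C)
    (hA : ∀ φ, ‖A φ‖ ^ 2 ≤ C * (‖D φ‖ ^ 2 + ‖S φ‖ ^ 2))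
    {k : WithLp 2 (X × Y)} (hk : k ∈ (LinearMap.range (pairMap D S))ᗮᗮ) :
    ∃ a : Z, (a, k.fst, k.snd) ∈ closure (range fun φ => (A φ, D φ, S φ)) := by
  rw [Submodule.orthogonal_orthogonal_eq_closure, ← SetLike.mem_coe,
    Submodule.topologicalClosure_coe] at hk
  obtain ⟨x, hx, hxk⟩ := mem_closure_iff_seq_limit.1 hk
  choose φ hφ using hx
  have hA' : ∀ φ, ‖A φ‖ ≤ √C * ‖pairMap D S φ‖ := by
    intro φ
    refine (sq_le_sq₀ (norm_nonneg _) (by positivity)).1 ?_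
    rw [mul_pow, Real.sq_sqrt hC, WithLp.prod_norm_sq_eq_of_L2]
    exact hA φ
  have hcau : CauchySeq fun m => A (φ m) := by
    have hxc := hxk.cauchySeq
    rw [Metric.cauchySeq_iff'] at hxc ⊢
    intro ε hε
    obtain ⟨N, hN⟩ := hxc (ε / (√C + 1)) (by positivity)
    refine ⟨N, fun m hm => ?_⟩
    have h1 := hN m hm
    rw [← hφ, ← hφ, dist_eq_norm, ← map_sub, lt_div_iff₀ (by positivity)] at h1
    rw [dist_eq_norm, ← map_sub]
    refine (hA' _).trans_lt (lt_of_le_of_lt ?_ h1)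
    rw [mul_comm]
    gcongr
    linarith
  obtain ⟨a, ha⟩ := cauchySeq_tendsto_of_complete hcau
  refine ⟨a, mem_closure_iff_seq_limit.2 ⟨fun m => (A (φ m), D (φ m), S (φ m)),
    fun m => ⟨φ m, rfl⟩, ha.prodMk_nhds ?_⟩⟩
  have hc : Continuous fun z : WithLp 2 (X × Y) => (z.fst, z.snd) := by fun_prop
  have := (hc.tendsto k).comp hxk
  refine this.congr fun m => ?_
  simp only [Function.comp, ← hφ]
  rfl

end Hilbert

section

variable {n : ℕ}

/-! ### Test forms, and the spaces of the theorem as orthogonal complements. -/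

section TestForms

theorem ContDiff.fderiv_top {F : Type*} [NormedAddCommGroup F] [NormedSpace ℝ F] {f : E n → F}
    (hf : ContDiff ℝ ∞ f) : ContDiff ℝ ∞ (fderiv ℝ f) :=
  hf.fderiv_right (m := ∞) (by norm_num)

theorem norm_sq_eq_integral {F : Type*} [NormedAddCommGroup F] [InnerProductSpace ℝ F]
    {μ : Measure (E n)} (f : Lp F 2 μ) : ‖f‖ ^ 2 = ∫ x, ‖f x‖ ^ 2 ∂μ := by
  rw [← real_inner_self_eq_norm_sq, L2.inner_def]
  simp

theorem norm_sq_toLp {F : Type*} [NormedAddCommGroup F] [InnerProductSpace ℝ F]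
    {μ : Measure (E n)} {f : E n → F} (hf : MemLp f 2 μ) :
    ‖hf.toLp f‖ ^ 2 = ∫ x, ‖f x‖ ^ 2 ∂μ := by
  rw [norm_sq_eq_integral]
  refine integral_congr_ae ?_
  filter_upwards [hf.coeFn_toLp] with x hx
  rw [hx]

theorem inner_toLp {F : Type*} [NormedAddCommGroup F] [InnerProductSpace ℝ F]
    {μ : Measure (E n)} (u : Lp F 2 μ) {f : E n → F} (hf : MemLp f 2 μ) :
    inner ℝ u (hf.toLp f) = ∫ x, inner ℝ (u x) (f x) ∂μ := by
  rw [L2.inner_def]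
  refine integral_congr_ae ?_
  filter_upwards [hf.coeFn_toLp] with x hx
  rw [hx]

variable (Ω : Set (E n))

/-- The space of test forms. -/
def testForms (p : ℕ) : Submodule ℝ (E n → Form n p) where
  carrier := {φ | IsTestForm Ω φ}
  add_mem' := fun {φ ψ} hφ hψ => ⟨hφ.1.add hψ.1, hφ.2.1.add hψ.2.1,
    (tsupport_add φ ψ).trans (union_subset hφ.2.2 hψ.2.2)⟩
  zero_mem' := ⟨contDiff_const, HasCompactSupport.zero, by
    rw [tsupport_eq_empty_iff.2 rfl]; exact empty_subset _⟩
  smul_mem' := fun c φ hφ => ⟨hφ.1.const_smul c, hφ.2.1.smul_left (f := fun _ => c),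
    (tsupport_smul_subset_right (fun _ => c) φ).trans hφ.2.2⟩

variable {Ω}

theorem IsTestForm.comp_fderiv {p q : ℕ} {φ : E n → Form n p} (hφ : IsTestForm Ω φ)
    (L : (E n →L[ℝ] Form n p) →L[ℝ] Form n q) : IsTestForm Ω fun x => L (fderiv ℝ φ x) := by
  refine ⟨L.contDiff.comp (ContDiff.fderiv_top hφ.1), ?_, ?_⟩
  · exact (hφ.2.1.fderiv ℝ).comp_left (map_zero L)
  · refine Subset.trans ?_ ((tsupport_fderiv_subset ℝ).trans hφ.2.2)
    exact closure_mono (Function.support_comp_subset (map_zero L) _)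

theorem IsTestForm.memLp {p : ℕ} {φ : E n → Form n p} (hφ : IsTestForm Ω φ) (μ : Measure (E n))
    [IsFiniteMeasureOnCompacts μ] : MemLp φ 2 μ :=
  hφ.1.continuous.memLp_of_hasCompactSupport hφ.2.1

/-- The inclusion of the test forms in `L₂`. -/
def inclL2 (Ω : Set (E n)) (p : ℕ) : testForms Ω p →ₗ[ℝ] L2Form Ω p where
  toFun φ := (φ.2.memLp (volume.restrict Ω)).toLp φ.1
  map_add' _ _ := MemLp.toLp_add _ _
  map_smul' _ _ := MemLp.toLp_const_smul _ _

/-- A first-order differential operator on test forms. -/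
def derivL2 (Ω : Set (E n)) {p q : ℕ} (L : (E n →L[ℝ] Form n p) →L[ℝ] Form n q) :
    testForms Ω p →ₗ[ℝ] L2Form Ω q where
  toFun φ := ((φ.2.comp_fderiv L).memLp (volume.restrict Ω)).toLp _
  map_add' φ ψ := by
    rw [← MemLp.toLp_add]
    congr 1
    ext1 x
    simp only [Pi.add_apply, Submodule.coe_add]
    rw [fderiv_add (φ.2.1.differentiable (by simp) x) (ψ.2.1.differentiable (by simp) x), map_add]
  map_smul' c φ := by
    rw [RingHom.id_apply, ← MemLp.toLp_const_smul]
    congr 1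
    ext1 x
    simp only [Pi.smul_apply, Submodule.coe_smul]
    rw [fderiv_const_smul (φ.2.1.differentiable (by simp) x), map_smul]

theorem inclL2_ae {p : ℕ} (φ : testForms Ω p) : inclL2 Ω p φ =ᵐ[volume.restrict Ω] φ.1 :=
  (φ.2.memLp (volume.restrict Ω)).coeFn_toLp

theorem derivL2_apply {p q : ℕ} (L : (E n →L[ℝ] Form n p) →L[ℝ] Form n q) (φ : testForms Ω p) :
    derivL2 Ω L φ = ((φ.2.comp_fderiv L).memLp (volume.restrict Ω)).toLp _ := rfl

theorem derivL2_ae {p q : ℕ} (L : (E n →L[ℝ] Form n p) →L[ℝ] Form n q) (φ : testForms Ω p) :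
    derivL2 Ω L φ =ᵐ[volume.restrict Ω] fun x => L (fderiv ℝ φ.1 x) :=
  ((φ.2.comp_fderiv L).memLp (volume.restrict Ω)).coeFn_toLp

/-- `φ ↦ dφ`. -/
abbrev dL2 (Ω : Set (E n)) (ℓ : ℕ) : testForms Ω ℓ →ₗ[ℝ] L2Form Ω (ℓ + 1) :=
  derivL2 Ω (wedgeL n ℓ (ℓ + 1))

/-- `φ ↦ d*φ`. -/
abbrev codL2 (Ω : Set (E n)) (ℓ : ℕ) : testForms Ω ℓ →ₗ[ℝ] L2Form Ω (ℓ - 1) :=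
  derivL2 Ω (contrL n ℓ (ℓ - 1))

theorem inner_dL2 {ℓ : ℕ} (v : L2Form Ω (ℓ + 1)) (φ : testForms Ω ℓ) :
    inner ℝ v (dL2 Ω ℓ φ) = ∫ x in Ω, inner ℝ (v x) (extD φ.1 x) :=
  inner_toLp v ((φ.2.comp_fderiv _).memLp _)

theorem inner_codL2 {ℓ : ℕ} (u : L2Form Ω (ℓ - 1)) (φ : testForms Ω ℓ) :
    inner ℝ u (codL2 Ω ℓ φ) = ∫ x in Ω, inner ℝ (u x) (codiff φ.1 x) :=
  inner_toLp u ((φ.2.comp_fderiv _).memLp _)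

theorem H01Form_eq (ℓ : ℕ) : H01Form Ω ℓ =
    closure (range fun φ => (inclL2 Ω ℓ φ, dL2 Ω ℓ φ, codL2 Ω ℓ φ)) := by
  unfold H01Form
  congr 1
  ext ⟨t0, t1, t2⟩
  constructor
  · rintro ⟨φ, hφ, h0, h1, h2⟩
    refine ⟨⟨φ, hφ⟩, ?_⟩
    refine Prod.ext ?_ (Prod.ext ?_ ?_)
    · exact Lp.ext ((inclL2_ae ⟨φ, hφ⟩).trans h0.symm)
    · exact Lp.ext ((derivL2_ae _ ⟨φ, hφ⟩).trans h1.symm)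
    · exact Lp.ext ((derivL2_ae _ ⟨φ, hφ⟩).trans h2.symm)
  · rintro ⟨φ, hφ⟩
    rw [← hφ]
    exact ⟨φ.1, φ.2, inclL2_ae φ, derivL2_ae _ φ, derivL2_ae _ φ⟩

theorem inKerD_iff {ℓ : ℕ} (u : L2Form Ω (ℓ - 1)) :
    InKerD Ω ℓ u ↔ u ∈ (LinearMap.range (codL2 Ω ℓ))ᗮ := by
  rw [mem_orthogonal_range_iff]
  simp only [inner_codL2]
  exact ⟨fun h φ => h φ.1 φ.2, fun h φ hφ => h ⟨φ, hφ⟩⟩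

theorem mem_spaceM_iff {ℓ : ℕ} (u : L2Form Ω (ℓ - 1)) :
    u ∈ spaceM Ω ℓ ↔ u ∈ (LinearMap.range (codL2 Ω ℓ))ᗮᗮ := by
  rw [Submodule.mem_orthogonal']
  simp only [spaceM, mem_ofPred_eq, inKerD_iff]

theorem conjugate_iff {ℓ : ℕ} (u : L2Form Ω (ℓ - 1)) (v : L2Form Ω (ℓ + 1)) :
    Conjugate Ω ℓ u v ↔ ∀ φ, inner ℝ u (codL2 Ω ℓ φ) = inner ℝ v (dL2 Ω ℓ φ) := by
  simp only [inner_codL2, inner_dL2]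
  exact ⟨fun h φ => h φ.1 φ.2, fun h φ hφ => h ⟨φ, hφ⟩⟩

theorem hasWeakD_iff {ℓ : ℕ} (u : L2Form Ω (ℓ - 1)) (f : E n → Form n ℓ) :
    HasWeakD Ω ℓ u f ↔
      ∀ φ : testForms Ω ℓ, inner ℝ u (codL2 Ω ℓ φ) = ∫ x in Ω, inner ℝ (f x) (φ.1 x) := by
  simp only [inner_codL2]
  exact ⟨fun h φ => h φ.1 φ.2, fun h φ hφ => h ⟨φ, hφ⟩⟩

end TestForms

/-! ### Integration by parts and the energy identity. -/

section Energy

theorem fderiv_fderiv_apply {F : Type*} [NormedAddCommGroup F] [NormedSpace ℝ F] {f : E n → F}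
    (hf : ContDiff ℝ ∞ f) (x v w : E n) :
    fderiv ℝ (fun y => fderiv ℝ f y v) x w = fderiv ℝ (fderiv ℝ f) x w v := by
  have h := (ContDiff.fderiv_top hf).differentiable (by simp) x
  rw [fderiv_clm_apply h (differentiableAt_const v)]
  simp

theorem fderiv_fderiv_comm {F : Type*} [NormedAddCommGroup F] [NormedSpace ℝ F] {f : E n → F}
    (hf : ContDiff ℝ ∞ f) (x v w : E n) :
    fderiv ℝ (fderiv ℝ f) x v w = fderiv ℝ (fderiv ℝ f) x w v :=
  (hf.contDiffAt.isSymmSndFDerivAt (by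
    rw [minSmoothness_of_isRCLikeNormedField]; exact WithTop.coe_le_coe.2 (le_top : (2 : ℕ∞) ≤ ⊤))) v w

theorem contDiff_fderiv_const {F : Type*} [NormedAddCommGroup F] [NormedSpace ℝ F] {f : E n → F}
    (hf : ContDiff ℝ ∞ f) (v : E n) : ContDiff ℝ ∞ fun x => fderiv ℝ f x v :=
  (ContDiff.fderiv_top hf).clm_apply contDiff_const

theorem integral_mul_fderiv {a b : E n → ℝ} (ha : ContDiff ℝ ∞ a) (hb : ContDiff ℝ ∞ b)
    (hcb : HasCompactSupport b) (v : E n) :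
    ∫ x, a x * fderiv ℝ b x v = -∫ x, fderiv ℝ a x v * b x := by
  have hb' := (contDiff_fderiv_const hb v).continuous
  have ha' := (contDiff_fderiv_const ha v).continuous
  exact integral_mul_fderiv_eq_neg_fderiv_mul_of_integrable
    ((ha'.mul hb.continuous).integrable_of_hasCompactSupport hcb.mul_left)
    ((ha.continuous.mul hb').integrable_of_hasCompactSupport (hcb.fderiv_apply ℝ v).mul_left)
    ((ha.continuous.mul hb.continuous).integrable_of_hasCompactSupport hcb.mul_left)
    (fun x _ => ha.differentiable (by simp) x) (fun x _ => hb.differentiable (by simp) x)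

/-- Moving the derivative off b on both sides leaves the two mixed second derivatives of a, which
agree. This is the symmetry needed in `wedge_contract_sum`. -/
theorem integral_fderiv_mul_fderiv_comm {a b : E n → ℝ} (ha : ContDiff ℝ ∞ a)
    (hb : ContDiff ℝ ∞ b) (hcb : HasCompactSupport b) (v w : E n) :
    ∫ x, fderiv ℝ a x v * fderiv ℝ b x w = ∫ x, fderiv ℝ a x w * fderiv ℝ b x v := by
  rw [integral_mul_fderiv (contDiff_fderiv_const ha v) hb hcb,
    integral_mul_fderiv (contDiff_fderiv_const ha w) hb hcb]
  simp only [fderiv_fderiv_apply ha]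
  congr 2
  ext x
  rw [fderiv_fderiv_comm ha]

theorem fderiv_coeff {p : ℕ} {φ : E n → Form n p} {x : E n} (hφ : DifferentiableAt ℝ φ x)
    (J : MIdx n p) (v : E n) : fderiv ℝ (fun y => φ y J) x v = fderiv ℝ φ x v J := by
  have h := ((EuclideanSpace.proj J : Form n p →L[ℝ] ℝ).hasFDerivAt
    (x := φ x)).comp x hφ.hasFDerivAt
  change fderiv ℝ (⇑(EuclideanSpace.proj J : Form n p →L[ℝ] ℝ) ∘ φ) x v = _
  rw [h.fderiv]
  rfl

theorem contDiff_coeff {p : ℕ} {φ : E n → Form n p} (hφ : ContDiff ℝ ∞ φ) (J : MIdx n p) :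
    ContDiff ℝ ∞ fun y => φ y J :=
  (EuclideanSpace.proj J : Form n p →L[ℝ] ℝ).contDiff.comp hφ

variable {Ω : Set (E n)}

theorem IsTestForm.setIntegral_eq {p : ℕ} {φ : E n → Form n p} (hφ : IsTestForm Ω φ)
    {G : Type*} [NormedAddCommGroup G] [NormedSpace ℝ G] {g : E n → G}
    (hg : ∀ x, x ∉ tsupport φ → g x = 0) : ∫ x in Ω, g x = ∫ x, g x :=
  setIntegral_eq_integral_of_forall_compl_eq_zero fun x hx => hg x fun h => hx (hφ.2.2 h)

theorem fderiv_eq_zero_of_notMem {F : Type*} [NormedAddCommGroup F] [NormedSpace ℝ F] {f : E n → F}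
    {x : E n} (hx : x ∉ tsupport f) : fderiv ℝ f x = 0 := by
  by_contra h
  exact hx (support_fderiv_subset ℝ h)

/-- The energy identity `‖dφ‖² + ‖d*φ‖² = ‖∇φ‖²` for test forms. -/
theorem energy_eq {ℓ : ℕ} (hℓ : 1 ≤ ℓ) (φ : testForms Ω ℓ) :
    ‖dL2 Ω ℓ φ‖ ^ 2 + ‖codL2 Ω ℓ φ‖ ^ 2 =
      ∑ i : Fin n, ∑ J : MIdx n ℓ, ∫ x in Ω, fderiv ℝ φ.1 x (stdVec i) J ^ 2 := by
  have hφ := φ.2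
  have hc : ∀ i (J : MIdx n ℓ), Continuous fun x => fderiv ℝ φ.1 x (stdVec i) J := fun i J =>
    (contDiff_coeff (contDiff_fderiv_const hφ.1 (stdVec i)) J).continuous
  have hs : ∀ i (J : MIdx n ℓ), HasCompactSupport fun x => fderiv ℝ φ.1 x (stdVec i) J := fun i J =>
    (hφ.2.1.fderiv_apply ℝ (stdVec i)).comp_left (g := fun y : Form n ℓ => y J) rfl
  have hint : ∀ i (J : MIdx n ℓ) j (L : MIdx n ℓ), Integrable (fun x =>
      fderiv ℝ φ.1 x (stdVec i) J * fderiv ℝ φ.1 x (stdVec j) L) (volume.restrict Ω) :=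
    fun i J j L => ((hc i J).mul (hc j L)).integrable_of_hasCompactSupport (hs j L).mul_left
  have key := wedge_contract_sum (p := ℓ) (q := ℓ - 1) (r := ℓ + 1) (Nat.sub_add_cancel hℓ) rfl
    (fun i J j L => ∫ x in Ω, fderiv ℝ φ.1 x (stdVec i) J * fderiv ℝ φ.1 x (stdVec j) L) (by
      intro i J j L
      rw [IsTestForm.setIntegral_eq hφ, IsTestForm.setIntegral_eq hφ]
      · have h := integral_fderiv_mul_fderiv_comm (contDiff_coeff hφ.1 J) (contDiff_coeff hφ.1 L)
          (hφ.2.1.comp_left (g := fun y : Form n ℓ => y L) rfl) (stdVec i) (stdVec j)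
        simpa only [fderiv_coeff (hφ.1.differentiable (by simp) _)] using h
      · intro x hx
        simp [fderiv_eq_zero_of_notMem hx]
      · intro x hx
        simp [fderiv_eq_zero_of_notMem hx])
  simp only [← sq] at key
  rw [← key, derivL2_apply, derivL2_apply]
  -- One computation serves both norms: a squared coefficient is a quadratic form in the first
  -- derivatives, integrated term by term.
  have e1 : ∀ (q : ℕ) (c : MIdx n q → Fin n → MIdx n ℓ → Fin n → MIdx n ℓ → ℝ)
      (g : E n → Form n q) (hg : MemLp g 2 (volume.restrict Ω)),
      (∀ x I, g x I ^ 2 = ∑ i, ∑ J, ∑ j, ∑ L, c I i J j L *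
        (fderiv ℝ φ.1 x (stdVec i) J * fderiv ℝ φ.1 x (stdVec j) L)) →
      ‖hg.toLp g‖ ^ 2 = ∑ I, ∑ i, ∑ J, ∑ j, ∑ L, c I i J j L *
        ∫ x in Ω, fderiv ℝ φ.1 x (stdVec i) J * fderiv ℝ φ.1 x (stdVec j) L := by
    intro q c g hg h
    rw [norm_sq_toLp]
    simp only [norm_sq_eq_sum, h]
    have hi := fun I i J j L => (hint i J j L).const_mul (c I i J j L)
    rw [integral_finsetSum]
    · refine Finset.sum_congr rfl fun I _ => ?_
      rw [integral_finsetSum]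
      · refine Finset.sum_congr rfl fun i _ => ?_
        rw [integral_finsetSum]
        · refine Finset.sum_congr rfl fun J _ => ?_
          rw [integral_finsetSum]
          · refine Finset.sum_congr rfl fun j _ => ?_
            rw [integral_finsetSum]
            · exact Finset.sum_congr rfl fun L _ => integral_const_mul _ _
            · exact fun L _ => hi I i J j L
          · exact fun j _ => integrable_finsetSum _ fun L _ => hi I i J j L
        · exact fun J _ => integrable_finsetSum _ fun j _ =>
            integrable_finsetSum _ fun L _ => hi I i J j L
      · exact fun i _ => integrable_finsetSum _ fun J _ => integrable_finsetSum _ fun j _ =>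
          integrable_finsetSum _ fun L _ => hi I i J j L
    · exact fun I _ => integrable_finsetSum _ fun i _ => integrable_finsetSum _ fun J _ =>
        integrable_finsetSum _ fun j _ => integrable_finsetSum _ fun L _ => hi I i J j L
  congr 1
  · exact e1 _ _ _ _ fun x I => sq_wedgeL _ I
  · exact e1 _ _ _ _ fun x K => sq_contrL _ K

end Energy

end

section

variable {n : ℕ} {Ω : Set (E n)}

/-! ### Hardy and Poincaré inequalities for forms. -/

section Hardy

theorem continuous_bdryDist (Ω : Set (E n)) : Continuous (bdryDist Ω) :=
  Metric.continuous_infDist_pt _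

theorem ne_univ_of_isBounded (hn : 1 ≤ n) (hΩb : Bornology.IsBounded Ω) : Ω ≠ univ := by
  have : Nonempty (Fin n) := ⟨⟨0, hn⟩⟩
  rintro rfl
  exact NormedSpace.unbounded_univ ℝ (E n) hΩb

/-- A point of Ωᶜ nearest to x lies on the frontier. The cutoffs below are built from the distance
to Ωᶜ, which vanishes outside Ω. -/
theorem bdryDist_le_infDist_compl (hn : 1 ≤ n) (hΩb : Bornology.IsBounded Ω) {x : E n}
    (hx : x ∈ Ω) : bdryDist Ω x ≤ Metric.infDist x Ωᶜ := by
  obtain ⟨y, hy, he⟩ := exists_mem_frontier_infDist_compl_eq_dist hx (ne_univ_of_isBounded hn hΩb)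
  rw [he]
  exact Metric.infDist_le_dist_of_mem hy

theorem bdryDist_pos (hn : 1 ≤ n) (hΩo : IsOpen Ω) (hΩb : Bornology.IsBounded Ω) {x : E n}
    (hx : x ∈ Ω) : 0 < bdryDist Ω x := by
  obtain ⟨y, hy, -⟩ := exists_mem_frontier_infDist_compl_eq_dist hx (ne_univ_of_isBounded hn hΩb)
  refine (isClosed_frontier.notMem_iff_infDist_pos ⟨y, hy⟩).1 fun h => ?_
  rw [hΩo.frontier_eq] at h
  exact h.2 hx

theorem exists_bdryDist_le (hΩb : Bornology.IsBounded Ω) :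
    ∃ R, 0 ≤ R ∧ ∀ x ∈ Ω, bdryDist Ω x ≤ R := by
  obtain ⟨R, hR⟩ := hΩb.isCompact_closure.exists_bound_of_continuousOn
    (continuous_bdryDist Ω).continuousOn
  exact ⟨max R 0, le_max_right _ _, fun x hx =>
    ((le_abs_self _).trans (hR x (subset_closure hx))).trans (le_max_left _ _)⟩

theorem norm_gradient_sq (ψ : E n → ℝ) (x : E n) :
    ‖gradient ψ x‖ ^ 2 = ∑ i, fderiv ℝ ψ x (stdVec i) ^ 2 := by
  rw [sum_apply_stdVec, gradient, LinearIsometryEquiv.norm_map]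

/-- Integrability is recorded separately, since a Bochner integral would be 0 without it. It holds
for any sign of h because the right-hand side of `HardyWith` is finite. -/
theorem hardy_scalar {h : ℝ} (hh : HardyWith Ω h) {ψ : E n → ℝ}
    (hψ : ContDiff ℝ ∞ ψ) (hc : HasCompactSupport ψ) (hs : tsupport ψ ⊆ Ω) :
    Integrable (fun x => ψ x ^ 2 / bdryDist Ω x ^ 2) (volume.restrict Ω) ∧
      (0 ≤ h → ∫ x in Ω, ψ x ^ 2 / bdryDist Ω x ^ 2 ≤
        h * ∑ i, ∫ x in Ω, fderiv ℝ ψ x (stdVec i) ^ 2) := by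
  have hm : MemLp ψ 2 (volume.restrict Ω) := hψ.continuous.memLp_of_hasCompactSupport hc
  have hgc : Continuous (gradient ψ) :=
    (InnerProductSpace.toDual ℝ (E n)).symm.continuous.comp (ContDiff.fderiv_top hψ).continuous
  have hgs : HasCompactSupport (gradient ψ) :=
    (hc.fderiv ℝ).comp_left (map_zero (InnerProductSpace.toDual ℝ (E n)).symm)
  have hmg : MemLp (gradient ψ) 2 (volume.restrict Ω) := hgc.memLp_of_hasCompactSupport hgs
  have key := hh (hm.toLp ψ, hmg.toLp _)
    (subset_closure ⟨ψ, ⟨hψ, hc, hs⟩, hm.coeFn_toLp, hmg.coeFn_toLp⟩)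
  have hn : ‖hmg.toLp (gradient ψ)‖ ^ 2 = ∑ i, ∫ x in Ω, fderiv ℝ ψ x (stdVec i) ^ 2 := by
    rw [norm_sq_toLp]
    simp only [norm_gradient_sq]
    refine integral_finsetSum _ fun i _ => Continuous.integrable_of_hasCompactSupport
      ((contDiff_fderiv_const hψ (stdVec i)).continuous.pow 2) ?_
    exact (hc.fderiv_apply ℝ (stdVec i)).comp_left (g := fun y : ℝ => y ^ 2) (by simp)
  rw [hn] at key
  have key' : ∫⁻ x in Ω, ENNReal.ofReal (ψ x ^ 2 / bdryDist Ω x ^ 2) ≤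
      ENNReal.ofReal (h * ∑ i, ∫ x in Ω, fderiv ℝ ψ x (stdVec i) ^ 2) := by
    refine le_of_eq_of_le (lintegral_congr_ae ?_) key
    filter_upwards [hm.coeFn_toLp] with x hx
    rw [hx]
  have hnn : ∀ x, 0 ≤ ψ x ^ 2 / bdryDist Ω x ^ 2 := fun x => by positivity
  have hmeas : AEStronglyMeasurable (fun x => ψ x ^ 2 / bdryDist Ω x ^ 2) (volume.restrict Ω) :=
    ((hψ.continuous.measurable.pow_const 2).div
      ((continuous_bdryDist Ω).measurable.pow_const 2)).aestronglyMeasurable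
  refine ⟨⟨hmeas, ?_⟩, fun h0 => ?_⟩
  · rw [hasFiniteIntegral_iff_ofReal (Filter.Eventually.of_forall hnn)]
    exact key'.trans_lt ENNReal.ofReal_lt_top
  · rw [integral_eq_lintegral_of_nonneg_ae (Filter.Eventually.of_forall hnn) hmeas]
    refine ENNReal.toReal_le_of_le_ofReal ?_ key'
    exact mul_nonneg h0 (Finset.sum_nonneg fun i _ => integral_nonneg fun x => sq_nonneg _)

theorem norm_sq_inv_bdryDist_smul {p : ℕ} (φ : E n → Form n p) (x : E n) :
    ‖(bdryDist Ω x)⁻¹ • φ x‖ ^ 2 = ∑ J, φ x J ^ 2 / bdryDist Ω x ^ 2 := by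
  rw [norm_smul, mul_pow, norm_sq_eq_sum, Finset.mul_sum]
  refine Finset.sum_congr rfl fun J _ => ?_
  rw [Real.norm_eq_abs, sq_abs, inv_pow]
  ring

theorem IsTestForm.coeff {p : ℕ} {φ : E n → Form n p} (hφ : IsTestForm Ω φ) (J : MIdx n p) :
    HasCompactSupport (fun x => φ x J) ∧ tsupport (fun x => φ x J) ⊆ Ω :=
  ⟨hφ.2.1.comp_left (g := fun y : Form n p => y J) rfl, Subset.trans (closure_mono
    (Function.support_comp_subset (g := fun y : Form n p => y J) rfl _)) hφ.2.2⟩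

theorem memLp_inv_bdryDist_smul {h : ℝ} (hh : HardyWith Ω h) {p : ℕ} (φ : testForms Ω p) :
    MemLp (fun x => (bdryDist Ω x)⁻¹ • φ.1 x) 2 (volume.restrict Ω) := by
  have hm : AEStronglyMeasurable (fun x => (bdryDist Ω x)⁻¹ • φ.1 x) (volume.restrict Ω) :=
    ((continuous_bdryDist Ω).measurable.inv.aestronglyMeasurable).smul
      φ.2.1.continuous.aestronglyMeasurable
  rw [memLp_two_iff_integrable_sq_norm hm]
  simp only [norm_sq_inv_bdryDist_smul]
  exact integrable_finsetSum _ fun J _ =>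
    (hardy_scalar hh (contDiff_coeff φ.2.1 J) (φ.2.coeff J).1 (φ.2.coeff J).2).1

/-- `φ ↦ φ / ρ`, when these are square integrable. -/
def weightL2 {p : ℕ}
    (hW : ∀ φ : testForms Ω p, MemLp (fun x => (bdryDist Ω x)⁻¹ • φ.1 x) 2 (volume.restrict Ω)) :
    testForms Ω p →ₗ[ℝ] L2Form Ω p where
  toFun φ := (hW φ).toLp _
  map_add' φ ψ := by
    rw [← MemLp.toLp_add]
    congr 1
    ext1 x
    exact smul_add _ _ _
  map_smul' c φ := by
    rw [RingHom.id_apply, ← MemLp.toLp_const_smul]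
    congr 1
    ext1 x
    exact smul_comm (bdryDist Ω x)⁻¹ c (φ.1 x)

theorem weightL2_apply {p : ℕ}
    (hW : ∀ φ : testForms Ω p, MemLp (fun x => (bdryDist Ω x)⁻¹ • φ.1 x) 2 (volume.restrict Ω))
    (φ : testForms Ω p) : weightL2 hW φ = (hW φ).toLp _ := rfl

/-- The Hardy inequality for test forms. -/
theorem hardy_testForms {h : ℝ} (h0 : 0 ≤ h) (hh : HardyWith Ω h) {ℓ : ℕ} (hℓ : 1 ≤ ℓ)
    (φ : testForms Ω ℓ) :
    ‖weightL2 (memLp_inv_bdryDist_smul hh) φ‖ ^ 2 ≤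
      h * (‖dL2 Ω ℓ φ‖ ^ 2 + ‖codL2 Ω ℓ φ‖ ^ 2) := by
  have hJ := fun J => hardy_scalar hh (contDiff_coeff φ.2.1 J) (φ.2.coeff J).1 (φ.2.coeff J).2
  rw [weightL2_apply, norm_sq_toLp, energy_eq hℓ]
  simp only [norm_sq_inv_bdryDist_smul]
  -- The Hardy inequality is applied to each coefficient, and by `energy_eq` the gradients add up
  -- exactly, so the constant stays h.
  rw [integral_finsetSum _ fun J _ => (hJ J).1, Finset.sum_comm, Finset.mul_sum]
  refine Finset.sum_le_sum fun J _ => ((hJ J).2 h0).trans_eq ?_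
  simp only [fderiv_coeff (φ.2.1.differentiable (by simp) _)]

/-- The Poincaré inequality for test forms. -/
theorem poincare_testForms (hn : 1 ≤ n) (hΩo : IsOpen Ω) (hΩb : Bornology.IsBounded Ω)
    {h : ℝ} (h0 : 0 ≤ h) (hh : HardyWith Ω h) {ℓ : ℕ} (hℓ : 1 ≤ ℓ) :
    ∃ C, 0 ≤ C ∧ ∀ φ : testForms Ω ℓ,
      ‖inclL2 Ω ℓ φ‖ ^ 2 ≤ C * (‖dL2 Ω ℓ φ‖ ^ 2 + ‖codL2 Ω ℓ φ‖ ^ 2) := by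
  obtain ⟨R, hR0, hR⟩ := exists_bdryDist_le hΩb
  -- Since ρ ≤ R on Ω, |φ| ≤ R |φ|/ρ, and Hardy controls φ/ρ.
  refine ⟨R ^ 2 * h, by positivity, fun φ => ?_⟩
  have h1 : ‖inclL2 Ω ℓ φ‖ ≤ R * ‖weightL2 (memLp_inv_bdryDist_smul hh) φ‖ := by
    refine Lp.norm_le_mul_norm_of_ae_le_mul ?_
    filter_upwards [inclL2_ae φ, (memLp_inv_bdryDist_smul hh φ).coeFn_toLp,
      ae_restrict_mem hΩo.measurableSet] with x hx1 hx2 hx3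
    have hρ := bdryDist_pos hn hΩo hΩb hx3
    rw [hx1, weightL2_apply, hx2, norm_smul, norm_inv, Real.norm_of_nonneg hρ.le, ← mul_assoc]
    refine le_mul_of_one_le_left (norm_nonneg _) ?_
    rw [← div_eq_mul_inv, one_le_div hρ]
    exact hR x hx3
  calc ‖inclL2 Ω ℓ φ‖ ^ 2 ≤ (R * ‖weightL2 (memLp_inv_bdryDist_smul hh) φ‖) ^ 2 := by gcongr
    _ ≤ R ^ 2 * (h * (‖dL2 Ω ℓ φ‖ ^ 2 + ‖codL2 Ω ℓ φ‖ ^ 2)) := by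
      rw [mul_pow]
      gcongr
      exact hardy_testForms h0 hh hℓ φ
    _ = _ := by ring

end Hardy

/-! ### Implications between the three inequalities. -/

section Implications

variable {ℓ : ℕ}

theorem FVWith.of_BAWith {c : ℝ} (hc : 1 ≤ c) (hBA : BAWith Ω ℓ c) : FVWith Ω ℓ (c - 1) := by
  intro u hu v huv
  obtain ⟨w, hw, hwu, hle⟩ := hBA u hu
  rw [H01Form_eq] at hw
  exact conjugate_bound_of_preimage (dL2 Ω ℓ) (codL2 Ω ℓ) hc ((conjugate_iff u v).1 huv)
    (mem_orthogonal_orthogonal_of_mem_closure _ _ hw) hwu hle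

/-- Hardy enters only through the Poincaré inequality, which turns a pair in K into an element of
`H01Form`; it does not affect the constant. -/
theorem BAWith.of_FVWith (hn : 1 ≤ n) (hΩo : IsOpen Ω) (hΩb : Bornology.IsBounded Ω)
    {h : ℝ} (h0 : 0 ≤ h) (hh : HardyWith Ω h) (hℓ : 1 ≤ ℓ) {γ : ℝ} (hγ : 0 ≤ γ)
    (hFV : FVWith Ω ℓ γ) : BAWith Ω ℓ (1 + γ) := by
  intro u hu
  obtain ⟨C, hC, hP⟩ := poincare_testForms hn hΩo hΩb h0 hh hℓ
  obtain ⟨k, hk, hku, hle⟩ := exists_preimage_of_conjugate_bound (dL2 Ω ℓ) (codL2 Ω ℓ) hγ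
    (fun u hu v huv => hFV u ((mem_spaceM_iff u).2 hu) v ((conjugate_iff u v).2 huv))
    ((mem_spaceM_iff u).1 hu)
  obtain ⟨a, ha⟩ := exists_mem_closure_of_mem_orthogonal_orthogonal (dL2 Ω ℓ) (codL2 Ω ℓ)
    (inclL2 Ω ℓ) hC hP hk
  rw [← H01Form_eq] at ha
  exact ⟨_, ha, hku, hle⟩

/-- The functional φ ↦ ⟨u, d*φ⟩ is bounded by √h ‖ρ du‖ |φ|₁, and its value at a solution w of d*w =
u is ‖u‖², where |w|₁ ≤ √c ‖u‖. -/
theorem IPWith.of_BAWith (hn : 1 ≤ n) (hΩo : IsOpen Ω) (hΩb : Bornology.IsBounded Ω)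
    {h : ℝ} (h0 : 0 ≤ h) (hh : HardyWith Ω h) (hℓ : 1 ≤ ℓ) {c : ℝ} (hc : 0 ≤ c)
    (hBA : BAWith Ω ℓ c) : IPWith Ω ℓ (h * c) := by
  intro u hu f hf hw
  rw [hasWeakD_iff] at hw
  rw [← norm_sq_toLp hf]
  set G := hf.toLp _ with hG
  have hbound : ∀ φ : testForms Ω ℓ, |inner ℝ u (codL2 Ω ℓ φ)| ≤
      √h * ‖G‖ * ‖pairMap (dL2 Ω ℓ) (codL2 Ω ℓ) φ‖ := by
    intro φ
    -- The weight is split as f · φ = (ρf) · (φ/ρ), legitimate because ρ > 0 on Ω.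
    have e : inner ℝ u (codL2 Ω ℓ φ) =
        inner ℝ G (weightL2 (memLp_inv_bdryDist_smul hh) φ) := by
      rw [hw, weightL2_apply, inner_toLp]
      refine integral_congr_ae ?_
      filter_upwards [hf.coeFn_toLp, ae_restrict_mem hΩo.measurableSet] with x hx hxΩ
      rw [hG, hx, real_inner_smul_left, real_inner_smul_right,
        mul_inv_cancel_left₀ (bdryDist_pos hn hΩo hΩb hxΩ).ne']
    have hW : ‖weightL2 (memLp_inv_bdryDist_smul hh) φ‖ ≤
        √h * ‖pairMap (dL2 Ω ℓ) (codL2 Ω ℓ) φ‖ := by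
      refine (sq_le_sq₀ (norm_nonneg _) (by positivity)).1 ?_
      rw [mul_pow, Real.sq_sqrt h0, WithLp.prod_norm_sq_eq_of_L2]
      exact hardy_testForms h0 hh hℓ φ
    rw [e]
    calc _ ≤ ‖G‖ * ‖weightL2 (memLp_inv_bdryDist_smul hh) φ‖ := abs_real_inner_le_norm _ _
      _ ≤ ‖G‖ * (√h * ‖pairMap (dL2 Ω ℓ) (codL2 Ω ℓ) φ‖) := by gcongr
      _ = _ := by ring
  obtain ⟨g, hg, hgφ⟩ := exists_inner_eq_of_bound (pairMap (dL2 Ω ℓ) (codL2 Ω ℓ))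
    ((innerSL ℝ u).toLinearMap ∘ₗ codL2 Ω ℓ) (by positivity) hbound
  obtain ⟨w, hw, hwu, hle⟩ := hBA u hu
  rw [H01Form_eq] at hw
  have hk := mem_orthogonal_orthogonal_of_mem_closure _ _ hw
  set k : WithLp 2 (L2Form Ω (ℓ + 1) × L2Form Ω (ℓ - 1)) := WithLp.toLp 2 (w.2.1, w.2.2)
  -- Both (0, u) and g represent the functional on pairs (dφ, d*φ), so they have the same pairing
  -- with k, although w is only a limit of test forms.
  have hz : WithLp.toLp 2 ((0 : L2Form Ω (ℓ + 1)), u) - g ∈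
      (LinearMap.range (pairMap (dL2 Ω ℓ) (codL2 Ω ℓ)))ᗮ := by
    rw [mem_orthogonal_range_iff]
    intro φ
    rw [inner_sub_left, hgφ, sub_eq_zero, WithLp.prod_inner_apply]
    simp only [inner_zero_left, zero_add]
    rfl
  have hzk := (Submodule.mem_orthogonal _ _).1 hk _ hz
  rw [inner_sub_left, sub_eq_zero, WithLp.prod_inner_apply] at hzk
  simp only [inner_zero_left, zero_add] at hzk
  have hku : inner ℝ u u = inner ℝ g k := by
    rw [← hzk]
    exact congrArg (inner ℝ u) hwu.symm
  have hkn : ‖k‖ ≤ √c * ‖u‖ := by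
    refine (sq_le_sq₀ (norm_nonneg _) (by positivity)).1 ?_
    rw [mul_pow, Real.sq_sqrt hc, WithLp.prod_norm_sq_eq_of_L2]
    exact hle
  rw [real_inner_self_eq_norm_sq] at hku
  rcases (norm_nonneg u).eq_or_lt with hu0 | hu0
  · rw [← hu0]
    have : 0 ≤ h * c * ‖G‖ ^ 2 := by positivity
    simpa using this
  · have h1 : ‖u‖ * ‖u‖ ≤ √h * ‖G‖ * √c * ‖u‖ := by
      calc ‖u‖ * ‖u‖ = inner ℝ g k := by rw [← hku, sq]
        _ ≤ ‖g‖ * ‖k‖ := real_inner_le_norm _ _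
        _ ≤ (√h * ‖G‖) * (√c * ‖u‖) := by gcongr
        _ = _ := by ring
    have h2 := le_of_mul_le_mul_right h1 hu0
    calc ‖u‖ ^ 2 ≤ (√h * ‖G‖ * √c) ^ 2 := by gcongr
      _ = _ := by
        rw [mul_pow, mul_pow, Real.sq_sqrt h0, Real.sq_sqrt hc]; ring

/-- The improved Poincaré inequality gives the Friedrichs–Velte inequality as soon as
`‖ρ du‖ ≤ 2 ‖v‖` in the weak form. -/
theorem FVWith.of_IPWith_of_bound (hn : 1 ≤ n) (hΩo : IsOpen Ω) (hΩb : Bornology.IsBounded Ω)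
    (hW : ∀ φ : testForms Ω ℓ, MemLp (fun x => (bdryDist Ω x)⁻¹ • φ.1 x) 2 (volume.restrict Ω))
    (hb : ∀ u v, Conjugate Ω ℓ u v → ∀ φ : testForms Ω ℓ,
      |inner ℝ u (codL2 Ω ℓ φ)| ≤ 2 * ‖v‖ * ‖weightL2 hW φ‖)
    {c : ℝ} (hc : 0 ≤ c) (hIP : IPWith Ω ℓ c) : FVWith Ω ℓ (4 * c) := by
  intro u hu v huv
  -- The vector g plays the role of ρ du: the distribution du is the function g/ρ.
  obtain ⟨g, hg, hgφ⟩ := exists_inner_eq_of_bound (weightL2 hW)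
    ((innerSL ℝ u).toLinearMap ∘ₗ codL2 Ω ℓ) (by positivity) (hb u v huv)
  have hae : (fun x => bdryDist Ω x • (bdryDist Ω x)⁻¹ • g x) =ᵐ[volume.restrict Ω] g := by
    filter_upwards [ae_restrict_mem hΩo.measurableSet] with x hx
    exact smul_inv_smul₀ (bdryDist_pos hn hΩo hΩb hx).ne' _
  have h1 := hIP u hu (fun x => (bdryDist Ω x)⁻¹ • g x) ((memLp_congr_ae hae).2 (Lp.memLp g)) (by
    rw [hasWeakD_iff]
    intro φ
    refine (hgφ φ).symm.trans ?_
    rw [weightL2_apply, inner_toLp]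
    simp only [real_inner_smul_left, real_inner_smul_right])
  have h2 : ∫ x in Ω, ‖bdryDist Ω x • (bdryDist Ω x)⁻¹ • g x‖ ^ 2 = ‖g‖ ^ 2 := by
    rw [norm_sq_eq_integral]
    refine integral_congr_ae ?_
    filter_upwards [hae] with x hx
    rw [hx]
  rw [h2] at h1
  calc ‖u‖ ^ 2 ≤ c * ‖g‖ ^ 2 := h1
    _ ≤ c * (2 * ‖v‖) ^ 2 := by gcongr
    _ = _ := by ring

end Implications

end

section

variable {n : ℕ}

/-! ### Mollification and smooth cutoffs. -/

section Mollify

/-- The mollification of `g` by a normalized bump function. -/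
def mollify {F : Type*} [NormedAddCommGroup F] [NormedSpace ℝ F]
    (η : ContDiffBump (0 : E n)) (g : E n → F) : E n → F :=
  convolution (η.normed volume) g (ContinuousLinearMap.lsmul ℝ ℝ) volume

variable {F : Type*} [NormedAddCommGroup F]

theorem mollify_apply [NormedSpace ℝ F] (η : ContDiffBump (0 : E n)) (g : E n → F) (x : E n) :
    mollify η g x = ∫ t, η.normed volume t • g (x - t) := rfl

theorem contDiff_mollify [NormedSpace ℝ F] [CompleteSpace F] (η : ContDiffBump (0 : E n))
    {g : E n → F} (hg : LocallyIntegrable g) : ContDiff ℝ ∞ (mollify η g) :=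
  η.hasCompactSupport_normed.contDiff_convolution_left _ η.contDiff_normed hg

theorem integrable_mollify_integrand [NormedSpace ℝ F] (η : ContDiffBump (0 : E n))
    {g : E n → F} (hg : LocallyIntegrable g) (x : E n) :
    Integrable fun t => η.normed volume t • g (x - t) :=
  η.hasCompactSupport_normed.convolutionExists_left (ContinuousLinearMap.lsmul ℝ ℝ)
    η.continuous_normed hg x

/-- The normalized bump is a probability density supported in the ball of radius `rOut`, so
averaging preserves a bound valid there. -/
theorem abs_integral_normed_mul_le (η : ContDiffBump (0 : E n)) {G : E n → ℝ} {B : ℝ}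
    (h : ∀ t, ‖t‖ < η.rOut → |G t| ≤ B) : |∫ t, η.normed volume t * G t| ≤ B := by
  have hB : ∫ t, η.normed volume t * B = B := by
    rw [integral_mul_const, η.integral_normed, one_mul]
  rw [← Real.norm_eq_abs, ← hB]
  refine norm_integral_le_of_norm_le (η.integrable_normed.mul_const B)
    (Filter.Eventually.of_forall fun t => ?_)
  rw [norm_mul, Real.norm_of_nonneg (η.nonneg_normed t), Real.norm_eq_abs]
  by_cases ht : η.normed volume t = 0
  · simp [ht]
  · have : t ∈ Function.support (η.normed volume) := ht
    rw [η.support_normed_eq, mem_ball_zero_iff] at this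
    exact mul_le_mul_of_nonneg_left (h t this) (η.nonneg_normed t)

/-- By Fubini the mollification becomes an average over translates of the test form, so only
translates need to be test forms in Ω. -/
theorem integral_inner_mollify [InnerProductSpace ℝ F] [CompleteSpace F]
    (η : ContDiffBump (0 : E n)) {g : E n → F} (hg : Integrable g) {ψ : E n → F}
    (hψ : Continuous ψ) (hψc : HasCompactSupport ψ) :
    ∫ x, inner ℝ (mollify η g x) (ψ x) =
      ∫ t, η.normed volume t * ∫ x, inner ℝ (g x) (ψ (x + t)) := by
  obtain ⟨C, hC⟩ := hψ.bounded_above_of_compact_support hψc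
  have h1 : ∀ x, inner ℝ (mollify η g x) (ψ x) =
      ∫ t, η.normed volume t * inner ℝ (g (x - t)) (ψ x) := by
    intro x
    rw [real_inner_comm, mollify_apply,
      ← integral_inner (integrable_mollify_integrand η hg.locallyIntegrable x)]
    simp only [real_inner_smul_right, real_inner_comm]
  simp only [h1]
  rw [integral_integral_swap]
  · refine integral_congr_ae (Filter.Eventually.of_forall fun t => ?_)
    simp only
    rw [integral_const_mul,
      ← integral_sub_right_eq_self (fun x => inner ℝ (g x) (ψ (x + t))) t]
    simp only [sub_add_cancel]
  · have h2 := (η.integrable_normed (μ := volume)).convolution_integrand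
      (ContinuousLinearMap.lsmul ℝ ℝ) hg
    have h3 : Function.uncurry (fun x t => η.normed volume t * inner ℝ (g (x - t)) (ψ x)) =
        fun p : E n × E n => inner ℝ (η.normed volume p.2 • g (p.1 - p.2)) (ψ p.1) := by
      ext p
      rw [real_inner_smul_left]
      rfl
    rw [h3]
    refine Integrable.mono' (h2.norm.const_mul C)
      (h2.aestronglyMeasurable.inner (hψ.comp continuous_fst).aestronglyMeasurable)
      (Filter.Eventually.of_forall fun p => ?_)
    rw [mul_comm]
    exact (norm_inner_le_norm _ _).trans (mul_le_mul_of_nonneg_left (hC _) (norm_nonneg _))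

/-- A bound for small mollifications passes to the limit. -/
theorem abs_integral_inner_le_of_mollify [InnerProductSpace ℝ F] [CompleteSpace F]
    {g : E n → F} (hg : Integrable g) {ψ : E n → F}
    (hψ : Continuous ψ) (hψc : HasCompactSupport ψ) {B δ : ℝ} (hδ : 0 < δ)
    (h : ∀ η : ContDiffBump (0 : E n), η.rOut ≤ δ → |∫ x, inner ℝ (mollify η g x) (ψ x)| ≤ B) :
    |∫ x, inner ℝ (g x) (ψ x)| ≤ B := by
  obtain ⟨C, hC⟩ := hψ.bounded_above_of_compact_support hψc
  -- The pairing with the mollification of g is the mollification of G at 0, and it tends to G 0 as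
  -- G is continuous.
  let G : E n → ℝ := fun z => ∫ x, inner ℝ (g x) (ψ (x - z))
  have hG : Continuous G := by
    refine continuous_of_dominated (bound := fun x => ‖g x‖ * C) (fun z => ?_) (fun z => ?_)
      (hg.norm.mul_const C) ?_
    · exact hg.aestronglyMeasurable.inner
        (hψ.comp (continuous_id.sub continuous_const)).aestronglyMeasurable
    · exact Filter.Eventually.of_forall fun x =>
        (norm_inner_le_norm _ _).trans (mul_le_mul_of_nonneg_left (hC _) (norm_nonneg _))
    · exact Filter.Eventually.of_forall fun x =>
        continuous_const.inner (hψ.comp (continuous_const.sub continuous_id))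
  let η : ℕ → ContDiffBump (0 : E n) := fun k =>
    ⟨δ / (k + 1) / 2, δ / (k + 1), by positivity, half_lt_self (by positivity)⟩
  have hη : Filter.Tendsto (fun k => (η k).rOut) Filter.atTop (nhds 0) :=
    tendsto_const_div_atTop_nhds_zero_nat δ |>.comp (Filter.tendsto_add_atTop_nat 1) |>.congr
      fun k => by simp [η]
  have hlim := ContDiffBump.convolution_tendsto_right_of_continuous (μ := volume) hη hG 0
  have hG0 : G 0 = ∫ x, inner ℝ (g x) (ψ x) := by simp [G]
  rw [← hG0]
  refine le_of_tendsto hlim.abs (Filter.Eventually.of_forall fun k => ?_)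
  refine le_of_eq_of_le ?_ (h (η k) ?_)
  · rw [integral_inner_mollify (η k) hg hψ hψc]
    congr 1
    change ∫ t, _ = _
    simp [G]
  · exact div_le_self hδ.le (by simp)

theorem lipschitzWith_mollify (η : ContDiffBump (0 : E n)) {g : E n → ℝ} (hg : LipschitzWith 1 g) :
    LipschitzWith 1 (mollify η g) := by
  refine LipschitzWith.of_dist_le_mul fun x y => ?_
  rw [NNReal.coe_one, one_mul, Real.dist_eq, mollify_apply, mollify_apply, ← integral_sub
    (integrable_mollify_integrand η hg.continuous.locallyIntegrable x)
    (integrable_mollify_integrand η hg.continuous.locallyIntegrable y)]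
  simp only [smul_eq_mul, ← mul_sub]
  refine abs_integral_normed_mul_le η fun t _ => ?_
  have := hg.dist_le_mul (x - t) (y - t)
  rwa [NNReal.coe_one, one_mul, Real.dist_eq, dist_sub_right] at this

/-- Smooth cutoff functions that are almost the distance to the complement. -/
theorem exists_cutoff {Ω : Set (E n)} (hΩo : IsOpen Ω) (hΩb : Bornology.IsBounded Ω)
    (hne : Ωᶜ.Nonempty) {K : Set (E n)} (hK : IsCompact K) (hKΩ : K ⊆ Ω) {θ : ℝ} (hθ : θ < 1) :
    ∃ δ > 0, ∃ χ : E n → ℝ, ContDiff ℝ ∞ χ ∧ HasCompactSupport χ ∧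
      (∀ x ∈ tsupport χ, δ ≤ Metric.infDist x Ωᶜ) ∧ (∀ x, ‖fderiv ℝ χ x‖ ≤ 1) ∧
      ∀ x ∈ K, θ * Metric.infDist x Ωᶜ ≤ χ x := by
  have hpos : ∀ x ∈ Ω, 0 < Metric.infDist x Ωᶜ := fun x hx =>
    (hΩo.isClosed_compl.notMem_iff_infDist_pos hne).1 fun h => h hx
  have hcont : Continuous fun x => Metric.infDist x Ωᶜ := Metric.continuous_infDist_pt _
  obtain ⟨m, hm0, hm⟩ : ∃ m > 0, ∀ x ∈ K, m ≤ Metric.infDist x Ωᶜ := by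
    rcases K.eq_empty_or_nonempty with rfl | hKn
    · exact ⟨1, one_pos, by simp⟩
    · obtain ⟨z, hz, hmin⟩ := hK.exists_isMinOn hKn hcont.continuousOn
      exact ⟨_, hpos z (hKΩ hz), fun x hx => hmin hx⟩
  -- On K the truncation costs 3δ and the mollification at most δ; in total 4δ = m(1 - θ) is at most
  -- (1 - θ) times the distance. The mollified support stays at distance at least 2δ from Ωᶜ.
  have hδ : 0 < m * (1 - θ) / 4 := by
    have := sub_pos.2 hθ
    positivity
  set δ := m * (1 - θ) / 4 with hδdef
  let g : E n → ℝ := fun x => max (Metric.infDist x Ωᶜ - 3 * δ) 0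
  have hg : LipschitzWith 1 g := by
    refine LipschitzWith.max_const ?_ 0
    refine LipschitzWith.of_dist_le_mul fun x y => ?_
    rw [dist_sub_right]
    exact (Metric.lipschitz_infDist_pt Ωᶜ).dist_le_mul x y
  let η : ContDiffBump (0 : E n) := ⟨δ / 2, δ, by positivity, half_lt_self hδ⟩
  have hsupp : ∀ x ∈ tsupport (mollify η g), 2 * δ ≤ Metric.infDist x Ωᶜ := by
    refine closure_minimal ?_ (isClosed_le continuous_const hcont)
    intro x hx
    by_contra hlt
    refine hx ?_
    have : |∫ t, η.normed volume t * g (x - t)| ≤ 0 := by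
      refine abs_integral_normed_mul_le η fun t ht => ?_
      have h1 := (Metric.lipschitz_infDist_pt Ωᶜ).dist_le_mul (x - t) x
      rw [NNReal.coe_one, one_mul, Real.dist_eq, dist_eq_norm, sub_sub_cancel_left, norm_neg] at h1
      have h2 := (le_abs_self _).trans h1
      have h3 : ‖t‖ < δ := ht
      have h4 : ¬ 2 * δ ≤ Metric.infDist x Ωᶜ := hlt
      have h5 : g (x - t) = 0 := max_eq_right (by linarith)
      rw [h5, abs_zero]
    exact abs_eq_zero.1 (le_antisymm this (abs_nonneg _))
  refine ⟨δ, hδ, mollify η g, contDiff_mollify η hg.continuous.locallyIntegrable, ?_,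
    fun x hx => by linarith [hsupp x hx], fun x => ?_, fun x hx => ?_⟩
  · refine hΩb.isCompact_closure.of_isClosed_subset (isClosed_tsupport _) fun x hx => ?_
    refine subset_closure ?_
    by_contra h
    have := hsupp x hx
    rw [Metric.infDist_zero_of_mem (show x ∈ Ωᶜ from h)] at this
    linarith
  · exact_mod_cast norm_fderiv_le_of_lipschitz ℝ (lipschitzWith_mollify η hg)
  · have h1 : dist (mollify η g x) (g x) ≤ δ := by
      refine ContDiffBump.dist_normed_convolution_le hg.continuous.aestronglyMeasurable
        fun y hy => ?_
      have := hg.dist_le_mul y x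
      rw [NNReal.coe_one, one_mul] at this
      exact this.trans (Metric.mem_ball.1 hy).le
    rw [Real.dist_eq] at h1
    have h2 := (abs_le.1 h1).1
    have h3 : Metric.infDist x Ωᶜ - 3 * δ ≤ g x := le_max_left _ _
    have h4 := mul_le_mul_of_nonneg_right (hm x hx) (sub_pos.2 hθ).le
    have h5 : m * (1 - θ) = 4 * δ := by rw [hδdef]; ring
    linarith

end Mollify

/-! ### Adjointness of d and d*, and d ∘ d = 0 for smooth forms. -/

section ExteriorCalculus

/-- `∫ ⟨U, d*φ⟩ = ∫ ⟨dU, φ⟩`. -/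
theorem integral_inner_contrL {p q : ℕ} {U : E n → Form n p} (hU : ContDiff ℝ ∞ U)
    {φ : E n → Form n q} (hφ : ContDiff ℝ ∞ φ) (hφc : HasCompactSupport φ) :
    ∫ x, inner ℝ (U x) (contrL n q p (fderiv ℝ φ x)) =
      ∫ x, inner ℝ (wedgeL n p q (fderiv ℝ U x)) (φ x) := by
  have hUc := fun K : MIdx n p => (contDiff_coeff hU K).continuous
  have hφcc := fun I : MIdx n q => (contDiff_coeff hφ I).continuous
  have hφs := fun I : MIdx n q => hφc.comp_left (g := fun y : Form n q => y I) rfl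
  have hdU := fun i (K : MIdx n p) =>
    (contDiff_coeff (contDiff_fderiv_const hU (stdVec i)) K).continuous
  have hdφ := fun i (I : MIdx n q) =>
    (contDiff_coeff (contDiff_fderiv_const hφ (stdVec i)) I).continuous
  have hdφs := fun i (I : MIdx n q) =>
    (hφc.fderiv_apply ℝ (stdVec i)).comp_left (g := fun y : Form n q => y I) rfl
  have i1 : ∀ i (K : MIdx n p) (I : MIdx n q), Integrable fun x =>
      -(wedgeSign i K.1 I.1 * (U x K * fderiv ℝ φ x (stdVec i) I)) := fun i K I =>
    ((((hUc K).mul (hdφ i I)).integrable_of_hasCompactSupport (hdφs i I).mul_left).const_mul _).neg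
  have i2 : ∀ i (K : MIdx n p) (I : MIdx n q), Integrable fun x =>
      wedgeSign i K.1 I.1 * (fderiv ℝ U x (stdVec i) K * φ x I) := fun i K I =>
    (((hdU i K).mul (hφcc I)).integrable_of_hasCompactSupport (hφs I).mul_left).const_mul _
  have hin : ∀ a b : ℝ, inner ℝ a b = a * b := fun a b => by simp [mul_comm]
  have e1 : ∀ x, inner ℝ (U x) (contrL n q p (fderiv ℝ φ x)) = ∑ K : MIdx n p, ∑ i, ∑ I : MIdx n q,
      -(wedgeSign i K.1 I.1 * (U x K * fderiv ℝ φ x (stdVec i) I)) := by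
    intro x
    rw [PiLp.inner_apply]
    refine Finset.sum_congr rfl fun K _ => ?_
    rw [contrL_apply, hin, mul_neg, Finset.mul_sum, ← Finset.sum_neg_distrib]
    refine Finset.sum_congr rfl fun i _ => ?_
    rw [Finset.mul_sum, ← Finset.sum_neg_distrib]
    exact Finset.sum_congr rfl fun I _ => by ring
  have e2 : ∀ x, inner ℝ (wedgeL n p q (fderiv ℝ U x)) (φ x) =
      ∑ K : MIdx n p, ∑ i, ∑ I : MIdx n q,
      wedgeSign i K.1 I.1 * (fderiv ℝ U x (stdVec i) K * φ x I) := by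
    intro x
    rw [PiLp.inner_apply]
    simp only [hin, wedgeL_apply, Finset.sum_mul]
    rw [Finset.sum_comm, Finset.sum_comm (t := (Finset.univ : Finset (Fin n)))]
    refine Finset.sum_congr rfl fun i _ => ?_
    rw [Finset.sum_comm]
    exact Finset.sum_congr rfl fun K _ => Finset.sum_congr rfl fun I _ => by ring
  simp only [e1, e2]
  rw [integral_finsetSum _ fun K _ => integrable_finsetSum _ fun i _ =>
      integrable_finsetSum _ fun I _ => i1 i K I,
    integral_finsetSum _ fun K _ => integrable_finsetSum _ fun i _ =>
      integrable_finsetSum _ fun I _ => i2 i K I]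
  refine Finset.sum_congr rfl fun K _ => ?_
  rw [integral_finsetSum _ fun i _ => integrable_finsetSum _ fun I _ => i1 i K I,
    integral_finsetSum _ fun i _ => integrable_finsetSum _ fun I _ => i2 i K I]
  refine Finset.sum_congr rfl fun i _ => ?_
  rw [integral_finsetSum _ fun I _ => i1 i K I, integral_finsetSum _ fun I _ => i2 i K I]
  refine Finset.sum_congr rfl fun I _ => ?_
  rw [integral_neg, integral_const_mul, integral_const_mul, ← mul_neg]
  congr 1
  have h := integral_mul_fderiv (contDiff_coeff hU K) (contDiff_coeff hφ I) (hφs I) (stdVec i)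
  simp only [fderiv_coeff (hU.differentiable (by simp) _),
    fderiv_coeff (hφ.differentiable (by simp) _)] at h
  rw [h, neg_neg]

/-- `d ∘ d = 0`. -/
theorem wedgeL_fderiv_wedgeL {p q r : ℕ} (hq : p + 1 = q) {U : E n → Form n p}
    (hU : ContDiff ℝ ∞ U) (x : E n) :
    wedgeL n q r (fderiv ℝ (fun y => wedgeL n p q (fderiv ℝ U y)) x) = 0 := by
  have hf : ∀ v, fderiv ℝ (fun y => wedgeL n p q (fderiv ℝ U y)) x v =
      wedgeL n p q (fderiv ℝ (fderiv ℝ U) x v) := by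
    intro v
    have h := (wedgeL n p q).hasFDerivAt.comp x
      ((ContDiff.fderiv_top hU).differentiable (by simp) x).hasFDerivAt
    change fderiv ℝ (wedgeL n p q ∘ fderiv ℝ U) x v = _
    rw [h.fderiv]
    rfl
  ext I
  rw [wedgeL_apply]
  simp only [hf, wedgeL_apply]
  set H : Fin n → Fin n → MIdx n p → ℝ := fun j i K =>
    fderiv ℝ (fderiv ℝ U) x (stdVec j) (stdVec i) K with hH
  have hsymm : ∀ i j K, H i j K = H j i K := fun i j K => by
    rw [hH]; simp only; rw [fderiv_fderiv_comm hU]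
  let c : Fin n → Fin n → MIdx n p → ℝ := fun j i K =>
    ∑ J : MIdx n q, wedgeSign i K.1 J.1 * wedgeSign j J.1 I.1
  have hc : ∀ i j K, c j i K + c i j K = 0 := fun i j K => wedgeSign_comp_anticomm hq i j K I
  have e : ∑ j, ∑ J : MIdx n q, wedgeSign j J.1 I.1 *
      ∑ i, ∑ K : MIdx n p, wedgeSign i K.1 J.1 * H j i K =
      ∑ j, ∑ i, ∑ K : MIdx n p, c j i K * H j i K := by
    refine Finset.sum_congr rfl fun j _ => ?_
    simp only [Finset.mul_sum, c, Finset.sum_mul]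
    rw [Finset.sum_comm]; refine Finset.sum_congr rfl fun i _ => ?_
    rw [Finset.sum_comm]; refine Finset.sum_congr rfl fun K _ => ?_
    exact Finset.sum_congr rfl fun J _ => by ring
  refine e.trans ?_
  -- The coefficient c is antisymmetric in i, j and the Hessian H is symmetric, so the sum equals
  -- its own negative.
  have h2 : ∑ j, ∑ i, ∑ K : MIdx n p, c j i K * H j i K =
      -∑ j, ∑ i, ∑ K : MIdx n p, c j i K * H j i K := by
    conv_lhs => rw [Finset.sum_comm]
    simp only [← Finset.sum_neg_distrib]
    refine Finset.sum_congr rfl fun i _ => Finset.sum_congr rfl fun j _ =>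
      Finset.sum_congr rfl fun K _ => ?_
    rw [hsymm j i, eq_neg_of_add_eq_zero_left (hc i j K)]
    ring
  change _ = (0 : ℝ)
  linarith

end ExteriorCalculus

end

section

variable {n : ℕ} {Ω : Set (E n)}

/-! ### The weighted estimate for du of a conjugate pair. -/

section WeightedBound

theorem IsTestForm.translate {p : ℕ} {φ : E n → Form n p} (hφ : ContDiff ℝ ∞ φ)
    (hc : HasCompactSupport φ) {t : E n} (h : ∀ x, x + t ∈ tsupport φ → x ∈ Ω) :
    IsTestForm Ω fun x => φ (x + t) := by
  refine ⟨hφ.comp (contDiff_id.add contDiff_const), hc.comp_homeomorph (Homeomorph.addRight t), ?_⟩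
  intro x hx
  refine h x ?_
  have := tsupport_comp_eq_preimage φ (Homeomorph.addRight t)
  change x ∈ tsupport (φ ∘ Homeomorph.addRight t) at hx
  rw [this] at hx
  exact hx

theorem isFiniteMeasure_restrict (hΩb : Bornology.IsBounded Ω) :
    IsFiniteMeasure (volume.restrict Ω) :=
  ⟨by rw [Measure.restrict_apply_univ]; exact hΩb.measure_lt_top⟩

theorem integrable_indicator_L2 (hΩo : IsOpen Ω) (hΩb : Bornology.IsBounded Ω) {p : ℕ}
    (u : L2Form Ω p) : Integrable (Ω.indicator u) := by
  have := isFiniteMeasure_restrict hΩb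
  rw [integrable_indicator_iff hΩo.measurableSet]
  exact (Lp.memLp u).integrable (by norm_num)

theorem integral_inner_indicator (hΩo : IsOpen Ω) {p : ℕ} (u : L2Form Ω p) (ψ : E n → Form n p) :
    ∫ x, inner ℝ (Ω.indicator u x) (ψ x) = ∫ x in Ω, inner ℝ (u x) (ψ x) := by
  rw [← integral_indicator hΩo.measurableSet]
  congr 1
  ext x
  by_cases hx : x ∈ Ω <;> simp [hx]

theorem norm_toLp_le_sqrt {p : ℕ} {g : E n → Form n p} (hg : MemLp g 2 volume) :
    ‖(hg.restrict Ω).toLp g‖ ≤ √(∫ x, ‖g x‖ ^ 2) := by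
  refine Real.le_sqrt_of_sq_le ?_
  rw [norm_sq_toLp]
  exact setIntegral_le_integral ((memLp_two_iff_integrable_sq_norm hg.1).1 hg)
    (Filter.Eventually.of_forall fun x => sq_nonneg _)

variable {ℓ : ℕ} {u : L2Form Ω (ℓ - 1)} {v : L2Form Ω (ℓ + 1)}

/-- Conjugacy passes to mollifications inside `Ω`. -/
theorem abs_integral_mollify_codiff_le (hΩo : IsOpen Ω) (hΩb : Bornology.IsBounded Ω)
    (huv : Conjugate Ω ℓ u v) (η : ContDiffBump (0 : E n)) {φ : E n → Form n ℓ}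
    (hφ : ContDiff ℝ ∞ φ) (hc : HasCompactSupport φ)
    (hs : ∀ x ∈ tsupport φ, η.rOut ≤ Metric.infDist x Ωᶜ) :
    |∫ x, inner ℝ (mollify η (Ω.indicator u) x) (codiff φ x)| ≤
      ‖v‖ * √(∫ x, ‖extD φ x‖ ^ 2) := by
  have hcod : IsTestForm univ (codiff φ) :=
    IsTestForm.comp_fderiv ⟨hφ, hc, subset_univ _⟩ (contrL n ℓ (ℓ - 1))
  rw [integral_inner_mollify η (integrable_indicator_L2 hΩo hΩb u) hcod.1.continuous hcod.2.1]
  refine abs_integral_normed_mul_le η fun t ht => ?_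
  -- A shift by less than `rOut` keeps the support inside Ω, so conjugacy applies to every
  -- translate; the L₂ norm of its exterior derivative is translation invariant.
  have htest : IsTestForm Ω fun x => φ (x + t) := by
    refine IsTestForm.translate hφ hc fun x hx => ?_
    by_contra hxΩ
    have h1 := (hs _ hx).trans (Metric.infDist_le_dist_of_mem (show x ∈ Ωᶜ from hxΩ))
    rw [dist_eq_norm, add_sub_cancel_left] at h1
    exact h1.not_gt ht
  have e1 : ∀ x, codiff φ (x + t) = codiff (fun x => φ (x + t)) x := fun x => by
    rw [codiff_eq, codiff_eq, fderiv_comp_add_right]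
  have e2 : ∀ x, extD (fun x => φ (x + t)) x = extD φ (x + t) := fun x => by
    rw [extD_eq, extD_eq, fderiv_comp_add_right]
  have hm : MemLp (extD fun x => φ (x + t)) 2 volume :=
    (htest.comp_fderiv (wedgeL n ℓ (ℓ + 1))).memLp volume
  have e3 : ∫ x, ‖extD (fun x => φ (x + t)) x‖ ^ 2 = ∫ x, ‖extD φ x‖ ^ 2 := by
    simp only [e2]
    exact integral_add_right_eq_self (fun x => ‖extD φ x‖ ^ 2) t
  rw [integral_inner_indicator hΩo u fun x => codiff φ (x + t)]
  simp only [e1]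
  rw [huv _ htest, ← inner_toLp v (hm.restrict Ω), ← e3]
  exact (abs_real_inner_le_norm _ _).trans
    (mul_le_mul_of_nonneg_left (norm_toLp_le_sqrt hm) (norm_nonneg v))

/-- Since d(dU) = 0, only the cutoff is differentiated: d(χ² dU) = 2χ dχ ∧ dU. This factor 2 becomes
the 4 in Γ ≤ 4P. -/
theorem norm_extD_sq_smul_le (hℓ : 1 ≤ ℓ) {U : E n → Form n (ℓ - 1)} (hU : ContDiff ℝ ∞ U)
    {χ : E n → ℝ} (hχ : ContDiff ℝ ∞ χ) (hχ1 : ∀ x, ‖fderiv ℝ χ x‖ ≤ 1) (x : E n) :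
    ‖extD (fun y => χ y ^ 2 • wedgeL n (ℓ - 1) ℓ (fderiv ℝ U y)) x‖ ≤
      2 * ‖χ x • wedgeL n (ℓ - 1) ℓ (fderiv ℝ U x)‖ := by
  have hf : DifferentiableAt ℝ (fun y => wedgeL n (ℓ - 1) ℓ (fderiv ℝ U y)) x :=
    ((wedgeL n (ℓ - 1) ℓ).contDiff.comp (ContDiff.fderiv_top hU)).differentiable (by simp) x
  have hχx : HasFDerivAt χ (fderiv ℝ χ x) x := (hχ.differentiable (by simp) x).hasFDerivAt
  have hd := (hχx.pow 2).smul hf.hasFDerivAt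
  have e : extD (fun y => χ y ^ 2 • wedgeL n (ℓ - 1) ℓ (fderiv ℝ U y)) x = (2 * χ x) •
      wedgeL n ℓ (ℓ + 1) ((fderiv ℝ χ x).smulRight (wedgeL n (ℓ - 1) ℓ (fderiv ℝ U x))) := by
    rw [extD_eq]
    refine (congrArg (wedgeL n ℓ (ℓ + 1)) hd.fderiv).trans ?_
    rw [map_add, map_smul, wedgeL_fderiv_wedgeL (Nat.sub_add_cancel hℓ) hU, smul_zero, zero_add,
      ← map_smul]
    congr 1
    ext1 w
    simp [smul_smul]
  rw [e, norm_smul, norm_smul, norm_mul, Real.norm_ofNat, mul_assoc]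
  gcongr
  refine (norm_wedgeL_smulRight_le (Nat.sub_add_cancel hℓ) rfl _ _).trans ?_
  exact mul_le_of_le_one_left (norm_nonneg _) (hχ1 x)

/-- `‖χ du_ε‖ ≤ 2 ‖v‖` for the mollifications `u_ε`. -/
theorem sqrt_integral_cutoff_le (hℓ : 1 ≤ ℓ) (hΩo : IsOpen Ω) (hΩb : Bornology.IsBounded Ω)
    (huv : Conjugate Ω ℓ u v) (η : ContDiffBump (0 : E n)) {χ : E n → ℝ} (hχ : ContDiff ℝ ∞ χ)
    (hχc : HasCompactSupport χ) (hχ1 : ∀ x, ‖fderiv ℝ χ x‖ ≤ 1)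
    (hs : ∀ x ∈ tsupport χ, η.rOut ≤ Metric.infDist x Ωᶜ) :
    √(∫ x, ‖χ x • wedgeL n (ℓ - 1) ℓ (fderiv ℝ (mollify η (Ω.indicator u)) x)‖ ^ 2) ≤
      2 * ‖v‖ := by
  set U := mollify η (Ω.indicator u) with hUdef
  have hU : ContDiff ℝ ∞ U :=
    contDiff_mollify η (integrable_indicator_L2 hΩo hΩb u).locallyIntegrable
  set f : E n → Form n ℓ := fun x => wedgeL n (ℓ - 1) ℓ (fderiv ℝ U x) with hfdef
  have hf : ContDiff ℝ ∞ f := (wedgeL n (ℓ - 1) ℓ).contDiff.comp (ContDiff.fderiv_top hU)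
  -- The test form χ² du_ε turns the conjugacy bound into N² ≤ ‖v‖ · 2N with N = ‖χ du_ε‖.
  have hφ : ContDiff ℝ ∞ fun y => χ y ^ 2 • f y := (hχ.pow 2).smul hf
  have hφc : HasCompactSupport fun y => χ y ^ 2 • f y :=
    (hχc.comp_left (g := fun y : ℝ => y ^ 2) (by simp)).smul_right
  have hφs : tsupport (fun y => χ y ^ 2 • f y) ⊆ tsupport χ :=
    (tsupport_smul_subset_left (fun y => χ y ^ 2) f).trans
      (closure_mono (Function.support_comp_subset (g := fun y : ℝ => y ^ 2) (by simp) χ))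
  have h1 := abs_integral_mollify_codiff_le hΩo hΩb huv η hφ hφc fun x hx => hs x (hφs hx)
  have h2 : ∫ x, inner ℝ (U x) (codiff (fun y => χ y ^ 2 • f y) x) = ∫ x, ‖χ x • f x‖ ^ 2 := by
    refine (integral_inner_contrL hU hφ hφc).trans (integral_congr_ae
      (Filter.Eventually.of_forall fun x => ?_))
    change inner ℝ (f x) (χ x ^ 2 • f x) = ‖χ x • f x‖ ^ 2
    rw [real_inner_smul_right, real_inner_self_eq_norm_sq, norm_smul, mul_pow, Real.norm_eq_abs,
      sq_abs]
  set N := √(∫ x, ‖χ x • f x‖ ^ 2) with hN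
  have hN0 : 0 ≤ N := Real.sqrt_nonneg _
  have hNsq : N ^ 2 = ∫ x, ‖χ x • f x‖ ^ 2 :=
    Real.sq_sqrt (integral_nonneg fun x => sq_nonneg _)
  have hmχ : MemLp (fun x => χ x • f x) 2 volume :=
    (hχ.continuous.smul hf.continuous).memLp_of_hasCompactSupport hχc.smul_right
  have h3 : √(∫ x, ‖extD (fun y => χ y ^ 2 • f y) x‖ ^ 2) ≤ 2 * N := by
    rw [Real.sqrt_le_left (by positivity), mul_pow, hNsq, ← integral_const_mul]
    refine integral_mono_of_nonneg (Filter.Eventually.of_forall fun x => sq_nonneg _)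
      (((memLp_two_iff_integrable_sq_norm hmχ.1).1 hmχ).const_mul _)
      (Filter.Eventually.of_forall fun x => ?_)
    simp only
    rw [← mul_pow]
    exact pow_le_pow_left₀ (norm_nonneg _) (norm_extD_sq_smul_le hℓ hU hχ hχ1 x) 2
  rw [← hUdef, h2, ← hNsq, abs_of_nonneg (sq_nonneg N)] at h1
  have h4 : N * N ≤ 2 * ‖v‖ * N := by
    have := mul_le_mul_of_nonneg_left h3 (norm_nonneg v)
    linarith
  rcases hN0.eq_or_lt with h0 | h0
  · rw [← h0]; positivity
  · exact le_of_mul_le_mul_right h4 h0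

/-- The weak form of `‖ρ du‖ ≤ 2 ‖v‖` for conjugate `u` and `v`. -/
theorem abs_inner_codL2_le (hn : 1 ≤ n) (hℓ : 1 ≤ ℓ) (hΩo : IsOpen Ω)
    (hΩb : Bornology.IsBounded Ω)
    (hW : ∀ φ : testForms Ω ℓ, MemLp (fun x => (bdryDist Ω x)⁻¹ • φ.1 x) 2 (volume.restrict Ω))
    (huv : Conjugate Ω ℓ u v) (φ : testForms Ω ℓ) :
    |inner ℝ u (codL2 Ω ℓ φ)| ≤ 2 * ‖v‖ * ‖weightL2 hW φ‖ := by
  -- The cutoff only satisfies χ ≥ θρ on the support of φ, which costs a factor θ⁻¹ until θ tends to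
  -- 1.
  have hθ : ∀ θ : ℝ, 0 < θ → θ < 1 →
      |inner ℝ u (codL2 Ω ℓ φ)| ≤ θ⁻¹ * (2 * ‖v‖ * ‖weightL2 hW φ‖) := by
    intro θ hθ0 hθ1
    obtain ⟨δ, hδ, χ, hχ, hχc, hχs, hχ1, hχK⟩ := exists_cutoff hΩo hΩb
      (nonempty_compl.2 (ne_univ_of_isBounded hn hΩb)) φ.2.2.1 φ.2.2.2 hθ1
    have hcod := φ.2.comp_fderiv (contrL n ℓ (ℓ - 1))
    rw [inner_codL2, ← integral_inner_indicator hΩo u]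
    refine abs_integral_inner_le_of_mollify (integrable_indicator_L2 hΩo hΩb u)
      hcod.1.continuous hcod.2.1 hδ fun η hη => ?_
    set U := mollify η (Ω.indicator u) with hUdef
    have hU : ContDiff ℝ ∞ U :=
      contDiff_mollify η (integrable_indicator_L2 hΩo hΩb u).locallyIntegrable
    rw [integral_inner_contrL hU φ.2.1 φ.2.2.1]
    set f : E n → Form n ℓ := fun x => wedgeL n (ℓ - 1) ℓ (fderiv ℝ U x) with hfdef
    have hf : ContDiff ℝ ∞ f := (wedgeL n (ℓ - 1) ℓ).contDiff.comp (ContDiff.fderiv_top hU)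
    have hN : √(∫ x, ‖χ x • f x‖ ^ 2) ≤ 2 * ‖v‖ :=
      sqrt_integral_cutoff_le hℓ hΩo hΩb huv η hχ hχc hχ1 fun x hx => hη.trans (hχs x hx)
    have hmχ : MemLp (fun x => χ x • f x) 2 volume :=
      (hχ.continuous.smul hf.continuous).memLp_of_hasCompactSupport hχc.smul_right
    have hbound : ∀ x ∈ Ω, ‖(χ x)⁻¹ • φ.1 x‖ ≤ θ⁻¹ * ‖(bdryDist Ω x)⁻¹ • φ.1 x‖ ∧
        (φ.1 x ≠ 0 → χ x ≠ 0) := by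
      intro x hx
      by_cases h0 : φ.1 x = 0
      · simp [h0]
      · have hρ := bdryDist_pos hn hΩo hΩb hx
        have h1 : θ * bdryDist Ω x ≤ χ x :=
          (mul_le_mul_of_nonneg_left (bdryDist_le_infDist_compl hn hΩb hx) hθ0.le).trans
            (hχK x (subset_tsupport _ h0))
        have h2 : 0 < θ * bdryDist Ω x := by positivity
        have h3 : 0 < χ x := h2.trans_le h1
        refine ⟨?_, fun _ => h3.ne'⟩
        rw [norm_smul, norm_smul, ← mul_assoc, norm_inv, norm_inv, Real.norm_of_nonneg h3.le,
          Real.norm_of_nonneg hρ.le, ← mul_inv]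
        gcongr
    have hbae : ∀ᵐ x ∂volume.restrict Ω,
        ‖(χ x)⁻¹ • φ.1 x‖ ≤ θ⁻¹ * ‖(bdryDist Ω x)⁻¹ • φ.1 x‖ := by
      filter_upwards [ae_restrict_mem hΩo.measurableSet] with x hx using (hbound x hx).1
    have hmb : MemLp (fun x => (χ x)⁻¹ • φ.1 x) 2 (volume.restrict Ω) :=
      (hW φ).of_le_mul (hχ.continuous.measurable.inv.aestronglyMeasurable.smul
        φ.2.1.continuous.aestronglyMeasurable) hbae
    have hbn : ‖hmb.toLp _‖ ≤ θ⁻¹ * ‖weightL2 hW φ‖ := by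
      refine Lp.norm_le_mul_norm_of_ae_le_mul ?_
      filter_upwards [hbae, hmb.coeFn_toLp, (hW φ).coeFn_toLp] with x h1 h2 h3
      rw [h2, weightL2_apply, h3]
      exact h1
    -- Here χ takes the place of ρ as the weight: f · φ = (χf) · (φ/χ), with χ > 0 wherever φ ≠ 0.
    have e : ∫ x, inner ℝ (f x) (φ.1 x) =
        inner ℝ ((hmχ.restrict Ω).toLp (fun x => χ x • f x)) (hmb.toLp _) := by
      rw [← IsTestForm.setIntegral_eq φ.2 fun x hx => by
        rw [image_eq_zero_of_notMem_tsupport hx, inner_zero_right], inner_toLp]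
      refine integral_congr_ae ?_
      filter_upwards [(hmχ.restrict Ω).coeFn_toLp, ae_restrict_mem hΩo.measurableSet] with x h1 h2
      rw [h1]
      by_cases h0 : φ.1 x = 0
      · simp [h0]
      · rw [real_inner_smul_left, real_inner_smul_right,
          mul_inv_cancel_left₀ ((hbound x h2).2 h0)]
    change |∫ x, inner ℝ (f x) (φ.1 x)| ≤ _
    rw [e]
    calc _ ≤ ‖(hmχ.restrict Ω).toLp (fun x => χ x • f x)‖ * ‖hmb.toLp _‖ :=
          abs_real_inner_le_norm _ _
      _ ≤ (2 * ‖v‖) * (θ⁻¹ * ‖weightL2 hW φ‖) := by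
          gcongr
          exact (norm_toLp_le_sqrt hmχ).trans hN
      _ = _ := by ring
  set a := |inner ℝ u (codL2 Ω ℓ φ)|
  set B := 2 * ‖v‖ * ‖weightL2 hW φ‖ with hB
  have hB0 : 0 ≤ B := by positivity
  by_contra! hlt
  have ha : 0 < a := hB0.trans_lt hlt
  -- If B < a, this θ lies in (0, 1) and `hθ` gives (a + B)/2 ≤ B, a contradiction.
  have h := hθ ((a + B) / (2 * a)) (by positivity) (by rw [div_lt_one (by positivity)]; linarith)
  rw [inv_div, div_mul_eq_mul_div, le_div_iff₀ (by positivity)] at h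
  nlinarith

end WeightedBound

/-! ### Nontriviality of M. -/

section Nontrivial

/-- For φ = g dx_I with g a bump and i ∈ I, put J = I \ {i}. Pairing d*φ with the form x_i dx_J,
whose exterior derivative is ±dx_I, gives ±∫ g ≠ 0. -/
theorem exists_codL2_ne_zero {ℓ : ℕ} (hℓ : 1 ≤ ℓ) (hℓn : ℓ ≤ n) (hΩo : IsOpen Ω)
    (hne : Ω.Nonempty) : ∃ φ : testForms Ω ℓ, codL2 Ω ℓ φ ≠ 0 := by
  obtain ⟨I, -, hI⟩ := Finset.exists_subset_card_eq
    (show ℓ ≤ (Finset.univ : Finset (Fin n)).card by simpa using hℓn)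
  obtain ⟨i, hi⟩ : I.Nonempty := Finset.card_pos.1 (by omega)
  let J : MIdx n (ℓ - 1) := ⟨I.erase i, by rw [Finset.card_erase_of_mem hi, hI]⟩
  have hs : wedgeSign i J.1 I ≠ 0 := by
    have : I = insert i J.1 := (Finset.insert_erase hi).symm
    rw [this, wedgeSign_insert (Finset.notMem_erase _ _)]
    exact pow_ne_zero _ (by norm_num)
  obtain ⟨z, hz⟩ := hne
  obtain ⟨r, hr, hball⟩ := Metric.isOpen_iff.1 hΩo z hz
  let g : ContDiffBump z := ⟨r / 4, r / 2, by positivity, by linarith⟩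
  let φ : E n → Form n ℓ := fun x => g x • EuclideanSpace.single ⟨I, hI⟩ (1 : ℝ)
  have hφ : IsTestForm Ω φ := by
    refine ⟨g.contDiff.smul contDiff_const, g.hasCompactSupport.smul_right, ?_⟩
    refine (tsupport_smul_subset_left g _).trans ?_
    rw [g.tsupport_eq]
    exact (Metric.closedBall_subset_ball (by change r / 2 < r; linarith)).trans hball
  refine ⟨⟨φ, hφ⟩, fun h0 => ?_⟩
  let L : E n →L[ℝ] Form n (ℓ - 1) :=
    (EuclideanSpace.proj i : E n →L[ℝ] ℝ).smulRight (EuclideanSpace.single J (1 : ℝ))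
  have h1 := integral_inner_contrL L.contDiff hφ.1 hφ.2.1
  have h2 : ∫ x, inner ℝ (L x) (contrL n ℓ (ℓ - 1) (fderiv ℝ φ x)) = 0 := by
    rw [← IsTestForm.setIntegral_eq hφ fun x hx => by
      rw [fderiv_eq_zero_of_notMem hx, map_zero, inner_zero_right]]
    refine integral_eq_zero_of_ae ?_
    have h3 := derivL2_ae (contrL n ℓ (ℓ - 1)) ⟨φ, hφ⟩
    rw [show derivL2 Ω (contrL n ℓ (ℓ - 1)) ⟨φ, hφ⟩ = 0 from h0] at h3
    filter_upwards [h3, Lp.coeFn_zero (Form n (ℓ - 1)) 2 (volume.restrict Ω)] with x h4 h5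
    rw [← h4, h5]
    exact inner_zero_right _
  have h3 : ∀ x, inner ℝ (wedgeL n (ℓ - 1) ℓ (fderiv ℝ L x)) (φ x) = wedgeSign i J.1 I * g x := by
    intro x
    rw [real_inner_smul_right, EuclideanSpace.inner_single_right, wedgeL_apply, L.fderiv,
      Finset.sum_eq_single i, Finset.sum_eq_single J]
    · simp [L, mul_comm]
    · intro K _ hK
      simp [L, hK]
    · simp
    · intro j _ hj
      simp [L, Ne.symm hj]
    · simp
  rw [h2] at h1
  simp only [h3, integral_const_mul] at h1
  rcases mul_eq_zero.1 h1.symm with h | h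
  · exact hs h
  · exact (g.integral_pos (μ := volume)).ne' h

/-- M contains some u ≠ 0, and d*w = u alone contributes ‖u‖² to |w|₁². This makes c - 1 a
legitimate Friedrichs–Velte constant. -/
theorem BAWith.one_le {ℓ : ℕ} (hℓ : 1 ≤ ℓ) (hℓn : ℓ ≤ n) (hΩo : IsOpen Ω) (hne : Ω.Nonempty)
    {c : ℝ} (hBA : BAWith Ω ℓ c) : 1 ≤ c := by
  obtain ⟨φ, hφ⟩ := exists_codL2_ne_zero hℓ hℓn hΩo hne
  obtain ⟨w, -, hw, hle⟩ := hBA (codL2 Ω ℓ φ)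
    ((mem_spaceM_iff _).2 (Submodule.le_orthogonal_orthogonal _ ⟨φ, rfl⟩))
  rw [hw] at hle
  have h1 : 0 < ‖codL2 Ω ℓ φ‖ ^ 2 := pow_pos (norm_pos_iff.2 hφ) 2
  have h2 := sq_nonneg ‖w.2.1‖
  by_contra! hc
  nlinarith

end Nontrivial

end

end FormIneq

end


/-! ### Equivalences and comparison of the optimal constants. -/

theorem mainTheorem1 {n ℓ : ℕ} (hℓ : 1 ≤ ℓ) (hℓn : ℓ + 1 ≤ n)
    (Ω : Set (EuclideanSpace ℝ (Fin n))) (hΩo : IsOpen Ω) (hΩc : IsConnected Ω)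
    (hΩb : Bornology.IsBounded Ω) (hH : FormIneq.SupportsHardy Ω) :
    (FormIneq.SupportsFV Ω ℓ ↔ FormIneq.SupportsIP Ω ℓ) ∧
    (FormIneq.SupportsBA Ω ℓ ↔ FormIneq.SupportsIP Ω ℓ) ∧
    (FormIneq.SupportsIP Ω ℓ →
      (FormIneq.baConst Ω ℓ - 1) / 4 = FormIneq.fvConst Ω ℓ / 4 ∧
      FormIneq.fvConst Ω ℓ / 4 ≤ FormIneq.ipConst Ω ℓ ∧
      FormIneq.ipConst Ω ℓ ≤ FormIneq.hardyConst Ω * FormIneq.baConst Ω ℓ ∧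
      FormIneq.hardyConst Ω * FormIneq.baConst Ω ℓ =
        FormIneq.hardyConst Ω * (1 + FormIneq.fvConst Ω ℓ)) := by
  have hn : 1 ≤ n := by omega
  obtain ⟨h, h0, hh⟩ := id hH
  have hIP_FV : ∀ c, 0 ≤ c → FormIneq.IPWith Ω ℓ c → FormIneq.FVWith Ω ℓ (4 * c) := fun c hc hIP =>
    FormIneq.FVWith.of_IPWith_of_bound hn hΩo hΩb (FormIneq.memLp_inv_bdryDist_smul hh)
      (fun u v huv => FormIneq.abs_inner_codL2_le hn hℓ hΩo hΩb _ huv) hc hIP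
  have hFV_BA : ∀ c, 0 ≤ c → FormIneq.FVWith Ω ℓ c → FormIneq.BAWith Ω ℓ (1 + c) :=
    fun c hc hFV => FormIneq.BAWith.of_FVWith hn hΩo hΩb h0.le hh hℓ hc hFV
  have hBA1 : ∀ c, FormIneq.BAWith Ω ℓ c → 1 ≤ c := fun c hc =>
    FormIneq.BAWith.one_le hℓ (by omega) hΩo hΩc.nonempty hc
  have hBA_FV : ∀ c, FormIneq.BAWith Ω ℓ c → FormIneq.FVWith Ω ℓ (c - 1) := fun c hBA =>
    FormIneq.FVWith.of_BAWith (hBA1 c hBA) hBA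
  have hFVmono : ∀ c c', c ≤ c' → FormIneq.FVWith Ω ℓ c → FormIneq.FVWith Ω ℓ c' :=
    fun c c' hcc hFV u hu v huv => (hFV u hu v huv).trans (by gcongr)
  have hBA_IP : ∀ k c, 0 < k → FormIneq.HardyWith Ω k → FormIneq.BAWith Ω ℓ c →
      FormIneq.IPWith Ω ℓ (k * c) := fun k c hk hkH hBA =>
    FormIneq.IPWith.of_BAWith hn hΩo hΩb hk.le hkH hℓ (zero_le_one.trans (hBA1 c hBA)) hBA
  have iFB : FormIneq.SupportsFV Ω ℓ → FormIneq.SupportsBA Ω ℓ := fun ⟨c, hc, hFV⟩ =>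
    ⟨1 + c, by positivity, hFV_BA c hc.le hFV⟩
  have iBI : FormIneq.SupportsBA Ω ℓ → FormIneq.SupportsIP Ω ℓ := fun ⟨c, hc, hBA⟩ =>
    ⟨h * c, by positivity, hBA_IP h c h0 hh hBA⟩
  have iIF : FormIneq.SupportsIP Ω ℓ → FormIneq.SupportsFV Ω ℓ := fun ⟨c, hc, hIP⟩ =>
    ⟨4 * c, by positivity, hIP_FV c hc.le hIP⟩
  refine ⟨⟨fun hF => iBI (iFB hF), iIF⟩, ⟨iBI, fun hI => iFB (iIF hI)⟩, fun hI => ?_⟩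
  have bdd : ∀ P : ℝ → Prop, BddBelow {c : ℝ | 0 < c ∧ P c} := fun P => ⟨0, fun c hc => hc.1.le⟩
  have hF := iIF hI
  have hB := iFB hF
  have hCG : FormIneq.baConst Ω ℓ = 1 + FormIneq.fvConst Ω ℓ := by
    apply le_antisymm
    · rw [← sub_le_iff_le_add']
      refine le_csInf hF fun c hc => ?_
      rw [sub_le_iff_le_add']
      exact csInf_le (bdd _) ⟨by linarith [hc.1], hFV_BA c hc.1.le hc.2⟩
    -- The slack ε is needed because c - 1 may be 0, while admissible constants are required to be
    -- positive.
    · refine le_csInf hB fun c hc => le_of_forall_pos_le_add fun ε hε => ?_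
      have h1 := hBA1 c hc.2
      have h2 : FormIneq.fvConst Ω ℓ ≤ c - 1 + ε :=
        csInf_le (bdd _) ⟨by linarith, hFVmono _ _ (by linarith) (hBA_FV c hc.2)⟩
      linarith
  refine ⟨by rw [hCG]; ring, ?_, ?_, by rw [hCG]⟩
  · refine le_csInf hI fun c hc => ?_
    have h1 : FormIneq.fvConst Ω ℓ ≤ 4 * c :=
      csInf_le (bdd _) ⟨by linarith [hc.1], hIP_FV c hc.1.le hc.2⟩
    linarith
  · have h1 : ∀ c, 0 < c → FormIneq.BAWith Ω ℓ c →
        FormIneq.ipConst Ω ℓ ≤ FormIneq.hardyConst Ω * c := by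
      intro c hc hBA
      rw [← div_le_iff₀ hc]
      refine le_csInf hH fun k hk => ?_
      rw [div_le_iff₀ hc]
      exact csInf_le (bdd _) ⟨mul_pos hk.1 hc, hBA_IP k c hk.1 hk.2 hBA⟩
    have hH0 : 0 ≤ FormIneq.hardyConst Ω := Real.sInf_nonneg fun k hk => hk.1.le
    -- A priori the infimum of the Hardy constants could be 0; then a single Babuška–Aziz constant
    -- suffices, and otherwise one divides by it.
    rcases hH0.eq_or_lt with h2 | h2
    · obtain ⟨c, hc, hBA⟩ := hB
      have := h1 c hc hBA
      rw [← h2, zero_mul] at this ⊢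
      exact this
    · rw [← div_le_iff₀' h2]
      refine le_csInf hB fun c hc => ?_
      rw [div_le_iff₀' h2]
      exact h1 c hc.1 hc.2
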